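/- Let $\Gamma$ be a tropical plane curve: a finite connected graph embedded in $\mathbb R^2$ without crossings, with at least one vertex, whose bounded edges are segments and whose unbounded edges are rays, all of rational slope, where each edge $e$ carries an integer weight $w_e\ge 1$ and at every vertex the weighted sum of the outgoing primitive integral vectors is zero. Edges are measured in lattice length, and every ray is completed by a point at infinity. The weight $w_v$ of a vertex $v$ is the number of interior lattice points of its dual face, the convex lattice polygon (up to translation) whose sides are the weighted outgoing primitive vectors at $v$ rotated by a right angle. Let $\varepsilon>0$. The paired metric graph $\Sigma$ has the vertices of $\Gamma$; each edge $e$ of $\Gamma$ is replaced by $w_e$ parallel edges of the same length (a ray by $w_e$ rays, each with its own point at infinity), and $w_v$ loops of length $\varepsilon$ are attached at each vertex $v$. The pairing morphism $\phi:\Sigma\to\Gamma$ collapses the loops and identifies parallel edges. Let $g_\Gamma$, $g_\Sigma$ be the first Betti numbers of the two graphs. Divisors are finite formal $\mathbb Z$-combinations of points. A rational function on $\Sigma$ is a continuous piecewise linear function with integer slopes and finitely many pieces, possibly with values $\pm\infty$ at points at infinity; its divisor has at each point the sum of the incoming slopes as coefficient, and these divisors form the group $\mathrm{Prin}(\Sigma)$.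 Put $\mathrm{Pic}(\Sigma)=\mathrm{Div}(\Sigma)/\mathrm{Prin}(\Sigma)$ and $K_\Sigma=\sum_p(\mathrm{val}(p)-2)\,p$. Let $\phi_*:\mathrm{Div}(\Sigma)\to\mathrm{Div}(\Gamma)$ be the pushforward $\phi_*(D)(P)=\sum_{\phi(P')=P}D(P')$, and put $\mathrm{Pic}(\Sigma,\Gamma)=\mathrm{Div}(\Gamma)/\phi_*(\mathrm{Prin}(\Sigma))$ and $K_\Gamma=\phi_*(K_\Sigma)$. The theta characteristic classes on $\Sigma$ are the $\theta\in\mathrm{Pic}(\Sigma)$ with $2\theta=[K_\Sigma]$, and those on $\Gamma$ are the $\theta\in\mathrm{Pic}(\Sigma,\Gamma)$ with $2\theta=[K_\Gamma]$. A class in $\mathrm{Pic}(\Sigma)$ is effective if it contains a divisor with non-negative coefficients. Then $\phi_*$ maps theta characteristic classes on $\Sigma$ to theta characteristic classes on $\Gamma$. There are exactly $2^{g_\Gamma}$ theta characteristic classes on $\Gamma$, and each of them has exactly $2^{g_\Sigma-g_\Gamma}$ theta characteristic classes on $\Sigma$ in its preimage. Exactly one of the theta characteristic classes on $\Gamma$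 has $2^{g_\Sigma-g_\Gamma}-1$ effective theta characteristic classes in its preimage; each of the others has $2^{g_\Sigma-g_\Gamma}$ effective theta characteristic classes in its preimage. -/

import Mathlib

open Set Filter Topology

noncomputable section

/-- A (finite, connected) metric graph, possibly with unbounded edges: finitely many vertices `V`,
bounded edges `E` with two (possibly equal) end vertices and a positive length, and unbounded
edges (rays) `R`, each attached to one vertex and isometric to `[0, ∞]`. -/
structure MetricGraph where
  V : Type
  E : Type
  R : Type
  fintypeV : Fintype V
  fintypeE : Fintype E
  fintypeR : Fintype R
  src : E → V
  tgt : E → V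
  len : E → ℝ
  base : R → V
  len_pos : ∀ e, 0 < len e
  nonempty : Nonempty V
  connected : ∀ u v : V, Relation.EqvGen (fun a b => ∃ e, src e = a ∧ tgt e = b) u v

namespace MetricGraph

attribute [instance] MetricGraph.fintypeV MetricGraph.fintypeE MetricGraph.fintypeR

variable (G : MetricGraph)

/-- The genus (first Betti number). For a connected graph `|V| ≤ |E| + 1`, and a ray together with
its point at infinity contributes nothing. -/
def genus : ℕ := Fintype.card G.E + 1 - Fintype.card G.V

/-- The points of the metric graph: vertices, interior points of bounded edges (at distance `t`
from the source), interior points of rays (at distance `t` from the base), and the point at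
infinity of every ray. -/
inductive Point : Type
  | vertex (v : G.V) : Point
  | edge (e : G.E) (t : ℝ) (ht : t ∈ Ioo 0 (G.len e)) : Point
  | ray (r : G.R) (t : ℝ) (ht : 0 < t) : Point
  | infty (r : G.R) : Point

/-- Half-edges at vertices: every bounded edge has one at its source and one at its target,
every ray has one at its base. -/
abbrev HalfEdge : Type := (G.E ⊕ G.E) ⊕ G.R

/-- The vertex from which a half-edge emanates. -/
def origin : G.HalfEdge → G.V := Sum.elim (Sum.elim G.src G.tgt) G.base

open Classical in
/-- The half-edges emanating from a vertex. A loop contributes two of them. -/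
def star (v : G.V) : Finset G.HalfEdge := Finset.univ.filter fun h => G.origin h = v

/-- The valency of a point. -/
def val : G.Point → ℕ
  | .vertex v => (G.star v).card
  | .edge _ _ _ => 2
  | .ray _ _ _ => 2
  | .infty _ => 1

/-- Divisors: the free abelian group on the points. -/
abbrev Divisor : Type := G.Point →₀ ℤ

/-- The canonical divisor `∑ (val p - 2) p`. The sum runs over the vertices and the points at
infinity, all other points having valency `2`; see `canonical_apply`. -/
def canonical : G.Divisor :=
  ∑ v : G.V, Finsupp.single (Point.vertex v) ((G.val (.vertex v) : ℤ) - 2) +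
    ∑ r : G.R, Finsupp.single (Point.infty r) ((G.val (.infty r) : ℤ) - 2)

theorem canonical_apply (p : G.Point) : G.canonical p = (G.val p : ℤ) - 2 := by
  classical
  cases p <;> simp [canonical, Finsupp.single_apply, val]

/-- On a short interval `[t, t + δ)` the function `f` is affine of integer slope `m`. -/
def IsRightSlope (f : ℝ → ℝ) (t : ℝ) (m : ℤ) : Prop :=
  ∀ᶠ s in 𝓝[>] t, f s = f t + m * (s - t)

/-- On a short interval `(t - δ, t]` the function `f` is affine of integer slope `m`. -/
def IsLeftSlope (f : ℝ → ℝ) (t : ℝ) (m : ℤ) : Prop :=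
  ∀ᶠ s in 𝓝[<] t, f s = f t + m * (s - t)

/-- On some interval `(T, ∞)` the function `f` is affine of integer slope `m`. -/
def IsFinalSlope (f : ℝ → ℝ) (m : ℤ) : Prop :=
  ∃ c : ℝ, ∀ᶠ s in atTop, f s = c + m * s

open Classical in
/-- The slope of `f` immediately to the right of `t` (junk value `0` if there is none). -/
def rightSlope (f : ℝ → ℝ) (t : ℝ) : ℤ := if h : ∃ m, IsRightSlope f t m then h.choose else 0

open Classical in
/-- The slope of `f` immediately to the left of `t` (junk value `0` if there is none). -/
def leftSlope (f : ℝ → ℝ) (t : ℝ) : ℤ := if h : ∃ m, IsLeftSlope f t m then h.choose else 0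

open Classical in
/-- The slope of `f` near `+∞` (junk value `0` if there is none). -/
def finalSlope (f : ℝ → ℝ) : ℤ := if h : ∃ m, IsFinalSlope f m then h.choose else 0

theorem IsRightSlope.eq {f : ℝ → ℝ} {t : ℝ} {m : ℤ} (h : IsRightSlope f t m) :
    rightSlope f t = m := by
  have hex : ∃ m, IsRightSlope f t m := ⟨m, h⟩
  have h' : IsRightSlope f t (rightSlope f t) := by
    rw [rightSlope, dif_pos hex]; exact hex.choose_spec
  obtain ⟨s, ⟨h1, h2⟩, hs⟩ := ((h'.and h).and self_mem_nhdsWithin).exists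
  have hs' : s - t ≠ 0 := sub_ne_zero.2 (ne_of_gt hs)
  have : ((rightSlope f t : ℤ) : ℝ) = m := mul_right_cancel₀ hs' (by linarith)
  exact_mod_cast this

theorem IsLeftSlope.eq {f : ℝ → ℝ} {t : ℝ} {m : ℤ} (h : IsLeftSlope f t m) :
    leftSlope f t = m := by
  have hex : ∃ m, IsLeftSlope f t m := ⟨m, h⟩
  have h' : IsLeftSlope f t (leftSlope f t) := by
    rw [leftSlope, dif_pos hex]; exact hex.choose_spec
  obtain ⟨s, ⟨h1, h2⟩, hs⟩ := ((h'.and h).and self_mem_nhdsWithin).exists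
  have hs' : s - t ≠ 0 := sub_ne_zero.2 (ne_of_lt hs)
  have : ((leftSlope f t : ℤ) : ℝ) = m := mul_right_cancel₀ hs' (by linarith)
  exact_mod_cast this

theorem IsFinalSlope.eq {f : ℝ → ℝ} {m : ℤ} (h : IsFinalSlope f m) : finalSlope f = m := by
  have hex : ∃ m, IsFinalSlope f m := ⟨m, h⟩
  have h' : IsFinalSlope f (finalSlope f) := by
    rw [finalSlope, dif_pos hex]; exact hex.choose_spec
  obtain ⟨c, hc⟩ := h
  obtain ⟨d, hd⟩ := h'
  obtain ⟨T, hT⟩ := eventually_atTop.1 (hc.and hd)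
  have h1 := hT T le_rfl
  have h2 := hT (T + 1) (by linarith)
  have : ((finalSlope f : ℤ) : ℝ) = m := by linarith [h1.1, h1.2, h2.1, h2.2]
  exact_mod_cast this

theorem IsRightSlope.exists_rightSlope {f : ℝ → ℝ} {t : ℝ} (h : ∃ m, IsRightSlope f t m) :
    IsRightSlope f t (rightSlope f t) := by
  obtain ⟨m, hm⟩ := h
  rw [hm.eq]; exact hm

theorem IsLeftSlope.exists_leftSlope {f : ℝ → ℝ} {t : ℝ} (h : ∃ m, IsLeftSlope f t m) :
    IsLeftSlope f t (leftSlope f t) := by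
  obtain ⟨m, hm⟩ := h
  rw [hm.eq]; exact hm

theorem IsFinalSlope.exists_finalSlope {f : ℝ → ℝ} (h : ∃ m, IsFinalSlope f m) :
    IsFinalSlope f (finalSlope f) := by
  obtain ⟨m, hm⟩ := h
  rw [hm.eq]; exact hm

theorem IsRightSlope.add {f g : ℝ → ℝ} {t : ℝ} {m n : ℤ} (hf : IsRightSlope f t m)
    (hg : IsRightSlope g t n) : IsRightSlope (f + g) t (m + n) := by
  filter_upwards [hf, hg] with s h1 h2
  simp only [Pi.add_apply, h1, h2]; push_cast; ring

theorem IsLeftSlope.add {f g : ℝ → ℝ} {t : ℝ} {m n : ℤ} (hf : IsLeftSlope f t m)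
    (hg : IsLeftSlope g t n) : IsLeftSlope (f + g) t (m + n) := by
  filter_upwards [hf, hg] with s h1 h2
  simp only [Pi.add_apply, h1, h2]; push_cast; ring

theorem IsFinalSlope.add {f g : ℝ → ℝ} {m n : ℤ} (hf : IsFinalSlope f m)
    (hg : IsFinalSlope g n) : IsFinalSlope (f + g) (m + n) := by
  obtain ⟨c, hf⟩ := hf
  obtain ⟨d, hg⟩ := hg
  refine ⟨c + d, ?_⟩
  filter_upwards [hf, hg] with s h1 h2
  simp only [Pi.add_apply, h1, h2]; push_cast; ring

theorem IsRightSlope.neg {f : ℝ → ℝ} {t : ℝ} {m : ℤ} (hf : IsRightSlope f t m) :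
    IsRightSlope (-f) t (-m) := by
  filter_upwards [hf] with s h1
  simp only [Pi.neg_apply, h1]; push_cast; ring

theorem IsLeftSlope.neg {f : ℝ → ℝ} {t : ℝ} {m : ℤ} (hf : IsLeftSlope f t m) :
    IsLeftSlope (-f) t (-m) := by
  filter_upwards [hf] with s h1
  simp only [Pi.neg_apply, h1]; push_cast; ring

theorem IsFinalSlope.neg {f : ℝ → ℝ} {m : ℤ} (hf : IsFinalSlope f m) :
    IsFinalSlope (-f) (-m) := by
  obtain ⟨c, hf⟩ := hf
  refine ⟨-c, ?_⟩
  filter_upwards [hf] with s h1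
  simp only [Pi.neg_apply, h1]; push_cast; ring

/-- A rational function: a continuous piecewise linear function with integer slopes, which may
become `±∞` at points at infinity (its value there is determined by continuity and not recorded).
`onEdge e` is used on `[0, len e]` only and `onRay r` on `[0, ∞)` only. Being affine of integer
slope on both sides near every point amounts, by compactness of `[0, len e]`, to being continuous
and piecewise linear with integer slopes and finitely many pieces; on rays one also asks for
affineness near infinity. -/
structure RationalFunction where
  atVertex : G.V → ℝ
  onEdge : G.E → ℝ → ℝ
  onRay : G.R → ℝ → ℝ
  edge_src : ∀ e, onEdge e 0 = atVertex (G.src e)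
  edge_tgt : ∀ e, onEdge e (G.len e) = atVertex (G.tgt e)
  ray_base : ∀ r, onRay r 0 = atVertex (G.base r)
  edge_right : ∀ e, ∀ t ∈ Ico 0 (G.len e), ∃ m, IsRightSlope (onEdge e) t m
  edge_left : ∀ e, ∀ t ∈ Ioc 0 (G.len e), ∃ m, IsLeftSlope (onEdge e) t m
  ray_right : ∀ r, ∀ t : ℝ, 0 ≤ t → ∃ m, IsRightSlope (onRay r) t m
  ray_left : ∀ r, ∀ t : ℝ, 0 < t → ∃ m, IsLeftSlope (onRay r) t m
  ray_final : ∀ r, ∃ m, IsFinalSlope (onRay r) m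

variable {G}

namespace RationalFunction

/-- The slope of a rational function along a half-edge, moving away from its origin. -/
def outSlope (f : G.RationalFunction) : G.HalfEdge → ℤ :=
  Sum.elim (Sum.elim (fun e => rightSlope (f.onEdge e) 0)
    (fun e => -leftSlope (f.onEdge e) (G.len e))) (fun r => rightSlope (f.onRay r) 0)

/-- The order of `f` at a point: the sum of the incoming slopes. -/
def ord (f : G.RationalFunction) : G.Point → ℤ
  | .vertex v => ∑ h ∈ G.star v, -f.outSlope h
  | .edge e t _ => leftSlope (f.onEdge e) t - rightSlope (f.onEdge e) t
  | .ray r t _ => leftSlope (f.onRay r) t - rightSlope (f.onRay r) t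
  | .infty r => finalSlope (f.onRay r)

/-- The zero function. -/
def zero : G.RationalFunction where
  atVertex _ := 0
  onEdge _ _ := 0
  onRay _ _ := 0
  edge_src _ := rfl
  edge_tgt _ := rfl
  ray_base _ := rfl
  edge_right _ _ _ := ⟨0, Eventually.of_forall fun s => by simp⟩
  edge_left _ _ _ := ⟨0, Eventually.of_forall fun s => by simp⟩
  ray_right _ _ _ := ⟨0, Eventually.of_forall fun s => by simp⟩
  ray_left _ _ _ := ⟨0, Eventually.of_forall fun s => by simp⟩
  ray_final _ := ⟨0, 0, Eventually.of_forall fun s => by simp⟩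

/-- The pointwise sum. -/
def add (f g : G.RationalFunction) : G.RationalFunction where
  atVertex v := f.atVertex v + g.atVertex v
  onEdge e := f.onEdge e + g.onEdge e
  onRay r := f.onRay r + g.onRay r
  edge_src e := by simp [f.edge_src, g.edge_src]
  edge_tgt e := by simp [f.edge_tgt, g.edge_tgt]
  ray_base r := by simp [f.ray_base, g.ray_base]
  edge_right e t ht := by
    obtain ⟨m, hm⟩ := f.edge_right e t ht
    obtain ⟨n, hn⟩ := g.edge_right e t ht
    exact ⟨m + n, hm.add hn⟩
  edge_left e t ht := by
    obtain ⟨m, hm⟩ := f.edge_left e t ht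
    obtain ⟨n, hn⟩ := g.edge_left e t ht
    exact ⟨m + n, hm.add hn⟩
  ray_right r t ht := by
    obtain ⟨m, hm⟩ := f.ray_right r t ht
    obtain ⟨n, hn⟩ := g.ray_right r t ht
    exact ⟨m + n, hm.add hn⟩
  ray_left r t ht := by
    obtain ⟨m, hm⟩ := f.ray_left r t ht
    obtain ⟨n, hn⟩ := g.ray_left r t ht
    exact ⟨m + n, hm.add hn⟩
  ray_final r := by
    obtain ⟨m, hm⟩ := f.ray_final r
    obtain ⟨n, hn⟩ := g.ray_final r
    exact ⟨m + n, hm.add hn⟩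

/-- The pointwise negative. -/
def neg (f : G.RationalFunction) : G.RationalFunction where
  atVertex v := -f.atVertex v
  onEdge e := -f.onEdge e
  onRay r := -f.onRay r
  edge_src e := by simp [f.edge_src]
  edge_tgt e := by simp [f.edge_tgt]
  ray_base r := by simp [f.ray_base]
  edge_right e t ht := (f.edge_right e t ht).elim fun m hm => ⟨-m, hm.neg⟩
  edge_left e t ht := (f.edge_left e t ht).elim fun m hm => ⟨-m, hm.neg⟩
  ray_right r t ht := (f.ray_right r t ht).elim fun m hm => ⟨-m, hm.neg⟩
  ray_left r t ht := (f.ray_left r t ht).elim fun m hm => ⟨-m, hm.neg⟩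
  ray_final r := (f.ray_final r).elim fun m hm => ⟨-m, hm.neg⟩

theorem ord_zero (p : G.Point) : (zero : G.RationalFunction).ord p = 0 := by
  have hr : ∀ t : ℝ, rightSlope (fun _ => (0 : ℝ)) t = 0 := fun t =>
    IsRightSlope.eq (Eventually.of_forall fun s => by simp)
  have hl : ∀ t : ℝ, leftSlope (fun _ => (0 : ℝ)) t = 0 := fun t =>
    IsLeftSlope.eq (Eventually.of_forall fun s => by simp)
  have hf : finalSlope (fun _ => (0 : ℝ)) = 0 :=
    IsFinalSlope.eq ⟨0, Eventually.of_forall fun s => by simp⟩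
  cases p with
  | vertex v =>
    refine Finset.sum_eq_zero fun h _ => ?_
    rcases h with (e | e) | r <;> simp [outSlope, zero, hr, hl]
  | edge e t ht => simp [ord, zero, hr, hl]
  | ray r t ht => simp [ord, zero, hr, hl]
  | infty r => simp [ord, zero, hf]

theorem ord_add (f g : G.RationalFunction) (p : G.Point) :
    (f.add g).ord p = f.ord p + g.ord p := by
  have er : ∀ e, ∀ t ∈ Ico 0 (G.len e), rightSlope (f.onEdge e + g.onEdge e) t =
      rightSlope (f.onEdge e) t + rightSlope (g.onEdge e) t := fun e t ht =>
    ((IsRightSlope.exists_rightSlope (f.edge_right e t ht)).add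
      (IsRightSlope.exists_rightSlope (g.edge_right e t ht))).eq
  have el : ∀ e, ∀ t ∈ Ioc 0 (G.len e), leftSlope (f.onEdge e + g.onEdge e) t =
      leftSlope (f.onEdge e) t + leftSlope (g.onEdge e) t := fun e t ht =>
    ((IsLeftSlope.exists_leftSlope (f.edge_left e t ht)).add
      (IsLeftSlope.exists_leftSlope (g.edge_left e t ht))).eq
  have rr : ∀ r, ∀ t : ℝ, 0 ≤ t → rightSlope (f.onRay r + g.onRay r) t =
      rightSlope (f.onRay r) t + rightSlope (g.onRay r) t := fun r t ht =>
    ((IsRightSlope.exists_rightSlope (f.ray_right r t ht)).add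
      (IsRightSlope.exists_rightSlope (g.ray_right r t ht))).eq
  have rl : ∀ r, ∀ t : ℝ, 0 < t → leftSlope (f.onRay r + g.onRay r) t =
      leftSlope (f.onRay r) t + leftSlope (g.onRay r) t := fun r t ht =>
    ((IsLeftSlope.exists_leftSlope (f.ray_left r t ht)).add
      (IsLeftSlope.exists_leftSlope (g.ray_left r t ht))).eq
  have rf : ∀ r, finalSlope (f.onRay r + g.onRay r) =
      finalSlope (f.onRay r) + finalSlope (g.onRay r) := fun r =>
    ((IsFinalSlope.exists_finalSlope (f.ray_final r)).add
      (IsFinalSlope.exists_finalSlope (g.ray_final r))).eq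
  cases p with
  | vertex v =>
    simp only [ord]
    rw [← Finset.sum_add_distrib]
    refine Finset.sum_congr rfl fun h _ => ?_
    rcases h with (e | e) | r
    · have := er e 0 ⟨le_rfl, G.len_pos e⟩
      simp only [outSlope, add, Sum.elim_inl, this]; ring
    · have := el e (G.len e) ⟨G.len_pos e, le_rfl⟩
      simp only [outSlope, add, Sum.elim_inl, Sum.elim_inr, this]; ring
    · have := rr r 0 le_rfl
      simp only [outSlope, add, Sum.elim_inr, this]; ring
  | edge e t ht =>
    have h1 := er e t ⟨ht.1.le, ht.2⟩
    have h2 := el e t ⟨ht.1, ht.2.le⟩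
    simp only [ord, add, h1, h2]; ring
  | ray r t ht =>
    have h1 := rr r t ht.le
    have h2 := rl r t ht
    simp only [ord, add, h1, h2]; ring
  | infty r => simp only [ord, add, rf]

theorem ord_neg (f : G.RationalFunction) (p : G.Point) : f.neg.ord p = -f.ord p := by
  have h := ord_add f f.neg p
  have h0 : (f.add f.neg) = zero := by
    simp only [add, neg, zero, add_neg_cancel, mk.injEq, true_and]
    exact ⟨rfl, rfl⟩
  rw [h0, ord_zero] at h
  linarith

end RationalFunction

variable (G)

/-- The subgroup of principal divisors, that is, divisors of rational functions. -/
def principal : AddSubgroup G.Divisor where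
  carrier := {D | ∃ f : G.RationalFunction, ∀ p, D p = f.ord p}
  zero_mem' := ⟨.zero, fun p => by simp [RationalFunction.ord_zero]⟩
  add_mem' := by
    rintro D D' ⟨f, hf⟩ ⟨g, hg⟩
    exact ⟨f.add g, fun p => by simp [RationalFunction.ord_add, hf, hg]⟩
  neg_mem' := by
    rintro D ⟨f, hf⟩
    exact ⟨f.neg, fun p => by simp [RationalFunction.ord_neg, hf]⟩

/-- The Picard group: divisors modulo linear equivalence. -/
abbrev Pic : Type := G.Divisor ⧸ G.principal

/-- The class of a divisor. -/
def toPic (D : G.Divisor) : G.Pic := QuotientAddGroup.mk D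

/-- The set of theta characteristic classes: classes of divisors `θ` with `2θ ∼ K`. -/
def thetaClasses : Set G.Pic :=
  {c | ∃ θ : G.Divisor, G.toPic θ = c ∧ G.toPic (2 • θ) = G.toPic G.canonical}

/-- A divisor class is effective if it contains an effective divisor. -/
def IsEffectiveClass (c : G.Pic) : Prop :=
  ∃ D : G.Divisor, (∀ p, 0 ≤ D p) ∧ G.toPic D = c

/-- The position in the plane of the points of a metric graph whose vertices are placed by `pos`
and whose bounded edges and rays are straight with direction vectors `dirE`, `dirR`. Points at
infinity have no position. -/
def position (pos : G.V → ℝ × ℝ) (dirE : G.E → ℤ × ℤ) (dirR : G.R → ℤ × ℤ) :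
    G.Point → Option (ℝ × ℝ)
  | .vertex v => some (pos v)
  | .edge e t _ => some (pos (G.src e) + t • (((dirE e).1 : ℝ), ((dirE e).2 : ℝ)))
  | .ray r t _ => some (pos (G.base r) + t • (((dirR r).1 : ℝ), ((dirR r).2 : ℝ)))
  | .infty _ => none

end MetricGraph

/-- A tropical plane curve: a metric graph embedded in the plane, with straight edges of rational
slope (`dirE`, `dirR` are primitive integer direction vectors, and lengths are lattice lengths)
and positive integer edge weights, satisfying the balancing condition. -/
structure TropicalPlaneCurve where
  graph : MetricGraph
  pos : graph.V → ℝ × ℝ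
  dirE : graph.E → ℤ × ℤ
  dirR : graph.R → ℤ × ℤ
  weightE : graph.E → ℕ
  weightR : graph.R → ℕ
  primitiveE : ∀ e, Int.gcd (dirE e).1 (dirE e).2 = 1
  primitiveR : ∀ r, Int.gcd (dirR r).1 (dirR r).2 = 1
  weightE_pos : ∀ e, 0 < weightE e
  weightR_pos : ∀ r, 0 < weightR r
  pos_tgt : ∀ e, pos (graph.tgt e) =
    pos (graph.src e) + graph.len e • (((dirE e).1 : ℝ), ((dirE e).2 : ℝ))
  /-- Distinct points of the graph have distinct positions: edges do not cross or overlap. -/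
  planar : ∀ p q x, graph.position pos dirE dirR p = some x →
    graph.position pos dirE dirR q = some x → p = q
  /-- At every vertex the weighted sum of the outgoing primitive vectors is zero. -/
  balanced : ∀ v, ∑ h ∈ graph.star v, Sum.elim (Sum.elim weightE weightE) weightR h •
    Sum.elim (Sum.elim dirE (fun e => -dirE e)) dirR h = 0

namespace TropicalPlaneCurve

open MetricGraph

variable (Γ : TropicalPlaneCurve)

/-- The genus of the underlying graph; the weights of the vertices are not counted. -/
def genus : ℕ := Γ.graph.genus

/-- The primitive direction vector of a half-edge, pointing away from its origin. -/
def outDir : Γ.graph.HalfEdge → ℤ × ℤ :=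
  Sum.elim (Sum.elim Γ.dirE (fun e => -Γ.dirE e)) Γ.dirR

/-- The weight of the edge containing a half-edge. -/
def outWeight : Γ.graph.HalfEdge → ℕ :=
  Sum.elim (Sum.elim Γ.weightE Γ.weightE) Γ.weightR

/-- The sum of `w_h • J u_h` over the half-edges `h` at `v` whose direction `u_h` has angle at most
`θ`, where `J` is the rotation by a right angle and angles lie in `(-π, π]`. -/
def dualCorner (v : Γ.graph.V) (θ : ℝ) : ℝ × ℝ :=
  open Classical in
  ∑ h ∈ (Γ.graph.star v).filter
      (fun h => Complex.arg ⟨((Γ.outDir h).1 : ℝ), ((Γ.outDir h).2 : ℝ)⟩ ≤ θ),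
    Γ.outWeight h • (-((Γ.outDir h).2 : ℝ), ((Γ.outDir h).1 : ℝ))

/-- The face dual to `v`, up to translation: the convex lattice polygon whose boundary, traversed
counterclockwise, consists of the vectors `w_h • J u_h`, for the half-edges `h` at `v` in the cyclic
order of their directions. One of its corners is placed at the origin. -/
def dualFace (v : Γ.graph.V) : Set (ℝ × ℝ) := convexHull ℝ (range (Γ.dualCorner v))

/-- The weight of a vertex: the number of lattice points in the interior of its dual face. -/
def vertexWeight (v : Γ.graph.V) : ℕ :=
  {z : ℤ × ℤ | ((z.1 : ℝ), (z.2 : ℝ)) ∈ interior (Γ.dualFace v)}.ncard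

/-- The paired metric graph: it has the vertices of `Γ`, every edge `e` is replaced by `w_e` edges
of the same length, every ray `r` by `w_r` rays (each with its own point at infinity), and `w_v`
loops of length `ε` are attached to every vertex `v`. -/
def paired (ε : ℝ) (hε : 0 < ε) : MetricGraph where
  V := Γ.graph.V
  E := (Σ e : Γ.graph.E, Fin (Γ.weightE e)) ⊕ (Σ v : Γ.graph.V, Fin (Γ.vertexWeight v))
  R := Σ r : Γ.graph.R, Fin (Γ.weightR r)
  fintypeV := inferInstance
  fintypeE := inferInstance
  fintypeR := inferInstance
  src := Sum.elim (fun x => Γ.graph.src x.1) (fun y => y.1)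
  tgt := Sum.elim (fun x => Γ.graph.tgt x.1) (fun y => y.1)
  len := Sum.elim (fun x => Γ.graph.len x.1) (fun _ => ε)
  base := fun x => Γ.graph.base x.1
  len_pos := by
    rintro (x | y)
    · exact Γ.graph.len_pos x.1
    · exact hε
  nonempty := Γ.graph.nonempty
  connected := fun u v => by
    refine Relation.EqvGen.mono ?_ _ _ (Γ.graph.connected u v)
    rintro a b ⟨e, h1, h2⟩
    exact ⟨Sum.inl ⟨e, ⟨0, Γ.weightE_pos e⟩⟩, h1, h2⟩

variable (ε : ℝ) (hε : 0 < ε)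

/-- The pairing morphism, which collapses loops and multiple edges. -/
def pairing : (Γ.paired ε hε).Point → Γ.graph.Point
  | .vertex v => .vertex v
  | .edge (Sum.inl x) t ht => .edge x.1 t ht
  | .edge (Sum.inr y) _ _ => .vertex y.1
  | .ray x t ht => .ray x.1 t ht
  | .infty x => .infty x.1

/-- The pushforward of divisors: the coefficient of `φ_* D` at `P` is the sum of the coefficients
of `D` over the preimages of `P`. -/
def pushDiv : (Γ.paired ε hε).Divisor →+ Γ.graph.Divisor :=
  Finsupp.mapDomain.addMonoidHom (Γ.pairing ε hε)

/-- The Picard group of `Γ` with respect to the paired graph: divisors on `Γ` modulo pushforwards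
of principal divisors. -/
abbrev Pic : Type := Γ.graph.Divisor ⧸ (Γ.paired ε hε).principal.map (Γ.pushDiv ε hε)

/-- The class in `Pic` of a divisor on `Γ`. -/
def toPic (D : Γ.graph.Divisor) : Γ.Pic ε hε := QuotientAddGroup.mk D

/-- The pushforward of divisor classes. -/
def pushPic : (Γ.paired ε hε).Pic →+ Γ.Pic ε hε :=
  QuotientAddGroup.map _ _ (Γ.pushDiv ε hε) (AddSubgroup.le_comap_map _ _)

/-- Theta characteristic classes on `Γ`: classes of divisors `θ` with `2θ ∼ K_Γ`, where `K_Γ` is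
the pushforward of the canonical divisor of the paired graph. -/
def thetaClasses : Set (Γ.Pic ε hε) :=
  {c | ∃ θ : Γ.graph.Divisor, Γ.toPic ε hε θ = c ∧
    Γ.toPic ε hε (2 • θ) = Γ.toPic ε hε (Γ.pushDiv ε hε (Γ.paired ε hε).canonical)}

/-- The theta characteristic classes on the paired graph that are mapped to `η`. -/
def thetaFiber (η : Γ.Pic ε hε) : Set (Γ.paired ε hε).Pic :=
  {θ | θ ∈ (Γ.paired ε hε).thetaClasses ∧ Γ.pushPic ε hε θ = η}

/-- The multiplicity of `η`: the number of effective theta characteristic classes on the paired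
graph that are mapped to `η`. -/
def multiplicity (η : Γ.Pic ε hε) : ℕ :=
  {θ | θ ∈ Γ.thetaFiber ε hε η ∧ (Γ.paired ε hε).IsEffectiveClass θ}.ncard

end TropicalPlaneCurve

end

noncomputable section

namespace MetricGraph

/-! ### Piecewise linear functions of one variable -/

/-! Both Picard groups are quotients of a divisor group by the divisors of `weightedFunctions`, the
piecewise linear families whose end values on an edge are the vertex values times the weight. On Σ
all weights are 1 (`mem_principal_iff`). Adding up a rational function on Σ over parallel edges
gives a weighted function on Γ, its divisor is the pushforward, and every weighted function on Γ
arises in this way (`mem_map_pushDiv_iff`).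

Let `2θ = K + div f`. Modulo 2, `K` is the weighted valency at every point, so the slopes of `f`
have constant parity along each bounded edge and the parity of the weight along each ray. Weight
plus slope modulo 2 is therefore a 1-chain on the bounded edges, and the order at the vertices shows
that it is a cycle. It depends only on the class of `θ`, since a function without zeros and poles
has slope zero along the bounded edges, and it determines the class, since a function with even
slopes can be halved (`exists_slopeParity_map`).

On Σ every cycle `γ` occurs: take the function that vanishes on the support of `γ`, is the distance
to it elsewhere on the bounded part, and has slope 1 on rays. The resulting `θ` is effective if `γ ≠
0` (`exists_isThetaFunction`). If `γ = 0`, all slopes are odd, and an effective `θ` would have a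
negative coefficient at a vertex where `f` is minimal (`IsThetaFunction.not_effective`). So exactly
one theta class on Σ is not effective.

On cycles, the pushforward of classes is summation over parallel edges, `pushChain`. Loops have zero
boundary, so a chain is a cycle exactly if its pushforward is. Hence the classes on Γ are all the
cycles of Γ, each fibre is a coset of the kernel of `pushChain`, of dimension `|E_Σ| - |E_Γ| = g_Σ -
g_Γ`, and the zero cycle of Σ lies in only one of the fibres. -/

theorem IsRightSlope.sum {ι : Type*} (s : Finset ι) {f : ι → ℝ → ℝ} {t : ℝ} {m : ι → ℤ}
    (h : ∀ i ∈ s, IsRightSlope (f i) t (m i)) :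
    IsRightSlope (∑ i ∈ s, f i) t (∑ i ∈ s, m i) := by
  have := (Filter.eventually_all_finset s).2 h
  filter_upwards [this] with x hx
  simp only [Finset.sum_apply]
  rw [Finset.sum_congr rfl hx, Finset.sum_add_distrib, ← Finset.sum_mul]
  push_cast; ring

theorem IsLeftSlope.sum {ι : Type*} (s : Finset ι) {f : ι → ℝ → ℝ} {t : ℝ} {m : ι → ℤ}
    (h : ∀ i ∈ s, IsLeftSlope (f i) t (m i)) :
    IsLeftSlope (∑ i ∈ s, f i) t (∑ i ∈ s, m i) := by
  have := (Filter.eventually_all_finset s).2 h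
  filter_upwards [this] with x hx
  simp only [Finset.sum_apply]
  rw [Finset.sum_congr rfl hx, Finset.sum_add_distrib, ← Finset.sum_mul]
  push_cast; ring

theorem IsFinalSlope.zero : IsFinalSlope 0 0 := ⟨0, Eventually.of_forall fun s => by simp⟩

theorem IsRightSlope.affine (a : ℝ) (m : ℤ) (t : ℝ) : IsRightSlope (fun s => a + m * s) t m :=
  Eventually.of_forall fun s => by ring

theorem IsLeftSlope.affine (a : ℝ) (m : ℤ) (t : ℝ) : IsLeftSlope (fun s => a + m * s) t m :=
  Eventually.of_forall fun s => by ring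

theorem IsFinalSlope.affine (a : ℝ) (m : ℤ) : IsFinalSlope (fun s => a + m * s) m :=
  ⟨a, Eventually.of_forall fun s => by ring⟩

theorem isRightSlope_and_isLeftSlope_of_Ioo {f : ℝ → ℝ} {a b c s : ℝ} {m : ℤ} (hs : s ∈ Ioo a b)
    (h : ∀ x ∈ Ioo a b, f x = c + m * x) : IsRightSlope f s m ∧ IsLeftSlope f s m := by
  have hn : ∀ᶠ x in 𝓝 s, f x = f s + m * (x - s) := by
    filter_upwards [Ioo_mem_nhds hs.1 hs.2] with x hx
    rw [h x hx, h s hs]; ring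
  exact ⟨hn.filter_mono nhdsWithin_le_nhds, hn.filter_mono nhdsWithin_le_nhds⟩

/-- Being affine just to the right of `t`, the function has no bend at the points there. This makes
slopes locally constant and bends isolated. -/
theorem IsRightSlope.eventually {f : ℝ → ℝ} {t : ℝ} {m : ℤ} (h : IsRightSlope f t m) :
    ∀ᶠ s in 𝓝[>] t, IsRightSlope f s m ∧ IsLeftSlope f s m := by
  obtain ⟨u, hu, hsub⟩ := mem_nhdsGT_iff_exists_Ioo_subset.1 h
  filter_upwards [Ioo_mem_nhdsGT hu] with s hs
  refine isRightSlope_and_isLeftSlope_of_Ioo (c := f t - m * t) hs fun x hx => ?_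
  have : f x = f t + m * (x - t) := hsub hx
  rw [this]; ring

theorem IsLeftSlope.eventually {f : ℝ → ℝ} {t : ℝ} {m : ℤ} (h : IsLeftSlope f t m) :
    ∀ᶠ s in 𝓝[<] t, IsRightSlope f s m ∧ IsLeftSlope f s m := by
  obtain ⟨u, hu, hsub⟩ := mem_nhdsLT_iff_exists_Ioo_subset.1 h
  filter_upwards [Ioo_mem_nhdsLT hu] with s hs
  refine isRightSlope_and_isLeftSlope_of_Ioo (c := f t - m * t) hs fun x hx => ?_
  have : f x = f t + m * (x - t) := hsub hx
  rw [this]; ring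

theorem IsFinalSlope.eventually {f : ℝ → ℝ} {m : ℤ} (h : IsFinalSlope f m) :
    ∀ᶠ s in atTop, IsRightSlope f s m ∧ IsLeftSlope f s m := by
  obtain ⟨c, hc⟩ := h
  obtain ⟨T, hT⟩ := eventually_atTop.1 hc
  filter_upwards [eventually_gt_atTop T] with s hs
  exact isRightSlope_and_isLeftSlope_of_Ioo (b := s + 1) ⟨hs, by linarith⟩
    fun x hx => hT x hx.1.le

theorem IsRightSlope.hasDerivWithinAt {f : ℝ → ℝ} {t : ℝ} {m : ℤ} (h : IsRightSlope f t m) :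
    HasDerivWithinAt f m (Ici t) t := by
  rw [← hasDerivWithinAt_Ioi_iff_Ici]
  have h1 : HasDerivWithinAt (fun s => f t + m * (s - t)) (m : ℝ) (Ioi t) t := by
    simpa using ((((hasDerivAt_id t).sub_const t).const_mul (m : ℝ)).const_add
      (f t)).hasDerivWithinAt (s := Ioi t)
  exact h1.congr_of_eventuallyEq h (by simp)

theorem IsLeftSlope.hasDerivWithinAt {f : ℝ → ℝ} {t : ℝ} {m : ℤ} (h : IsLeftSlope f t m) :
    HasDerivWithinAt f m (Iic t) t := by
  rw [← hasDerivWithinAt_Iio_iff_Iic]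
  have h1 : HasDerivWithinAt (fun s => f t + m * (s - t)) (m : ℝ) (Iio t) t := by
    simpa using ((((hasDerivAt_id t).sub_const t).const_mul (m : ℝ)).const_add
      (f t)).hasDerivWithinAt (s := Iio t)
  exact h1.congr_of_eventuallyEq h (by simp)

/-- Piecewise linear functions with integer slopes on `[0, L]`. -/
def piecewiseLinear (L : ℝ) : AddSubgroup (ℝ → ℝ) where
  carrier := {f | (∀ t ∈ Ico 0 L, ∃ m, IsRightSlope f t m) ∧ ∀ t ∈ Ioc 0 L, ∃ m, IsLeftSlope f t m}
  zero_mem' := ⟨fun _ _ => ⟨0, Eventually.of_forall fun s => by simp⟩,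
    fun _ _ => ⟨0, Eventually.of_forall fun s => by simp⟩⟩
  add_mem' := by
    rintro f g ⟨hf, hf'⟩ ⟨hg, hg'⟩
    refine ⟨fun t ht => ?_, fun t ht => ?_⟩
    · obtain ⟨m, hm⟩ := hf t ht
      obtain ⟨n, hn⟩ := hg t ht
      exact ⟨_, hm.add hn⟩
    · obtain ⟨m, hm⟩ := hf' t ht
      obtain ⟨n, hn⟩ := hg' t ht
      exact ⟨_, hm.add hn⟩
  neg_mem' := by
    rintro f ⟨hf, hf'⟩
    exact ⟨fun t ht => (hf t ht).elim fun m hm => ⟨_, hm.neg⟩,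
      fun t ht => (hf' t ht).elim fun m hm => ⟨_, hm.neg⟩⟩

/-- Piecewise linear functions with integer slopes and finitely many pieces on `[0, ∞)`. -/
def piecewiseLinearRay : AddSubgroup (ℝ → ℝ) where
  carrier := {f | (∀ L, f ∈ piecewiseLinear L) ∧ ∃ m, IsFinalSlope f m}
  zero_mem' := ⟨fun _ => zero_mem _, 0, IsFinalSlope.zero⟩
  add_mem' := by
    rintro f g ⟨hf, m, hm⟩ ⟨hg, n, hn⟩
    exact ⟨fun L => add_mem (hf L) (hg L), _, hm.add hn⟩
  neg_mem' := by
    rintro f ⟨hf, m, hm⟩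
    exact ⟨fun L => neg_mem (hf L), _, hm.neg⟩

/-! ### Piecewise linear functions on a bounded interval -/

section Interval

variable {L : ℝ} {f g : ℝ → ℝ}

theorem isRightSlope_rightSlope (hf : f ∈ piecewiseLinear L) {t : ℝ} (ht : t ∈ Ico 0 L) :
    IsRightSlope f t (rightSlope f t) := IsRightSlope.exists_rightSlope (hf.1 t ht)

theorem isLeftSlope_leftSlope (hf : f ∈ piecewiseLinear L) {t : ℝ} (ht : t ∈ Ioc 0 L) :
    IsLeftSlope f t (leftSlope f t) := IsLeftSlope.exists_leftSlope (hf.2 t ht)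

theorem rightSlope_add (hf : f ∈ piecewiseLinear L) (hg : g ∈ piecewiseLinear L) {t : ℝ}
    (ht : t ∈ Ico 0 L) : rightSlope (f + g) t = rightSlope f t + rightSlope g t :=
  ((isRightSlope_rightSlope hf ht).add (isRightSlope_rightSlope hg ht)).eq

theorem leftSlope_add (hf : f ∈ piecewiseLinear L) (hg : g ∈ piecewiseLinear L) {t : ℝ}
    (ht : t ∈ Ioc 0 L) : leftSlope (f + g) t = leftSlope f t + leftSlope g t :=
  ((isLeftSlope_leftSlope hf ht).add (isLeftSlope_leftSlope hg ht)).eq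

theorem rightSlope_sum {ι : Type*} (s : Finset ι) {f : ι → ℝ → ℝ}
    (hf : ∀ i ∈ s, f i ∈ piecewiseLinear L) {t : ℝ} (ht : t ∈ Ico 0 L) :
    rightSlope (∑ i ∈ s, f i) t = ∑ i ∈ s, rightSlope (f i) t :=
  (IsRightSlope.sum s fun i hi => isRightSlope_rightSlope (hf i hi) ht).eq

theorem leftSlope_sum {ι : Type*} (s : Finset ι) {f : ι → ℝ → ℝ}
    (hf : ∀ i ∈ s, f i ∈ piecewiseLinear L) {t : ℝ} (ht : t ∈ Ioc 0 L) :
    leftSlope (∑ i ∈ s, f i) t = ∑ i ∈ s, leftSlope (f i) t :=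
  (IsLeftSlope.sum s fun i hi => isLeftSlope_leftSlope (hf i hi) ht).eq

theorem continuousOn_of_mem_piecewiseLinear (hf : f ∈ piecewiseLinear L) :
    ContinuousOn f (Icc 0 L) := by
  intro t ht
  have hr : ContinuousWithinAt f (Icc 0 L ∩ Ici t) t := by
    rcases ht.2.lt_or_eq with h | rfl
    · exact (isRightSlope_rightSlope hf ⟨ht.1, h⟩).hasDerivWithinAt.continuousWithinAt.mono
        inter_subset_right
    · exact continuousWithinAt_singleton.mono fun x hx => le_antisymm hx.1.2 hx.2
  have hl : ContinuousWithinAt f (Icc 0 L ∩ Iic t) t := by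
    rcases ht.1.lt_or_eq with h | rfl
    · exact (isLeftSlope_leftSlope hf ⟨h, ht.2⟩).hasDerivWithinAt.continuousWithinAt.mono
        inter_subset_right
    · exact continuousWithinAt_singleton.mono fun x hx => le_antisymm hx.2 hx.1.1
  refine (hl.union hr).mono fun x hx => ?_
  rcases le_total x t with h | h
  · exact Or.inl ⟨hx, h⟩
  · exact Or.inr ⟨hx, h⟩

/-- If the slopes on both sides of every interior point agree modulo `n`, then all slopes agree
modulo `n`. -/
theorem slopes_modEq (hf : f ∈ piecewiseLinear L) {n : ℤ}
    (h : ∀ t ∈ Ioo 0 L, leftSlope f t ≡ rightSlope f t [ZMOD n]) :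
    (∀ t ∈ Ico 0 L, rightSlope f t ≡ rightSlope f 0 [ZMOD n]) ∧
      ∀ t ∈ Ioc 0 L, leftSlope f t ≡ rightSlope f 0 [ZMOD n] := by
  -- The residue of the right slope is locally constant: to the right of `t` because `f` is affine
  -- there, to the left because the two slopes at `t` are congruent. Connectedness makes it
  -- constant. For `n = 0` congruence is equality.
  have hc : ContinuousOn (fun t => rightSlope f t % n) (Ico 0 L) := by
    intro t ht
    have key : ∀ᶠ s in 𝓝[Ico 0 L] t, rightSlope f s % n = rightSlope f t % n := by
      have hr : ∀ᶠ s in 𝓝[>] t, rightSlope f s % n = rightSlope f t % n := by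
        filter_upwards [(isRightSlope_rightSlope hf ht).eventually] with s hs
        rw [hs.1.eq]
      have hl : ∀ᶠ s in 𝓝[<] t, s ∈ Ico 0 L → rightSlope f s % n = rightSlope f t % n := by
        rcases ht.1.lt_or_eq with h0 | rfl
        · filter_upwards [(isLeftSlope_leftSlope hf ⟨h0, ht.2.le⟩).eventually] with s hs _
          rw [hs.1.eq]; exact h t ⟨h0, ht.2⟩
        · filter_upwards [self_mem_nhdsWithin] with s hs hs'
          exact absurd hs (not_lt.2 hs'.1)
      rw [eventually_nhdsWithin_iff] at hr hl ⊢
      filter_upwards [hr, hl] with s h1 h2 h3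
      rcases lt_trichotomy s t with hs | rfl | hs
      · exact h2 hs h3
      · rfl
      · exact h1 hs
    exact (continuousWithinAt_const (b := rightSlope f t % n)).congr_of_eventuallyEq key rfl
  have hR : ∀ t ∈ Ico 0 L, rightSlope f t ≡ rightSlope f 0 [ZMOD n] := fun t ht =>
    isPreconnected_Ico.constant hc ht ⟨le_rfl, ht.1.trans_lt ht.2⟩
  refine ⟨hR, fun t ht => ?_⟩
  -- The left slope at `t` is also the right slope at points slightly to the left of `t`.
  have h1 := (isLeftSlope_leftSlope hf ht).eventually
  obtain ⟨s, hs, hs'⟩ := (h1.and (Ioo_mem_nhdsLT ht.1)).exists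
  rw [← hs.1.eq]
  exact hR s ⟨hs'.1.le, hs'.2.trans_le ht.2⟩

/-- The continuous function `f s - m * s` has right derivative zero, hence is constant. -/
theorem eq_affine_of_rightSlope_eq (hf : f ∈ piecewiseLinear L) {m : ℤ}
    (h : ∀ t ∈ Ico 0 L, rightSlope f t = m) : ∀ t ∈ Icc 0 L, f t = f 0 + m * t := by
  intro t ht
  have := constant_of_has_deriv_right_zero (f := fun s => f s - m * s) (a := 0) (b := L)
    ((continuousOn_of_mem_piecewiseLinear hf).sub (by fun_prop)) (fun x hx => by
      have h1 := (isRightSlope_rightSlope hf hx).hasDerivWithinAt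
      rw [h x hx] at h1
      have h2 := h1.sub ((hasDerivAt_id x).const_mul (m : ℝ)).hasDerivWithinAt (s := Ici x)
      simp only [mul_one, sub_self] at h2
      exact h2) t ht
  simp only [mul_zero, sub_zero] at this
  linarith

/-- Every point of `[0, L]` has a neighbourhood containing no bend except possibly the point itself;
finitely many of these cover the compact interval. -/
theorem finite_breakpoints (hf : f ∈ piecewiseLinear L) :
    {t ∈ Ioo 0 L | leftSlope f t ≠ rightSlope f t}.Finite := by
  set S := {t ∈ Ioo 0 L | leftSlope f t ≠ rightSlope f t}
  have hU : ∀ t ∈ Icc 0 L, {s | s ∈ S → s = t} ∈ 𝓝 t := by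
    intro t ht
    have hr : ∀ᶠ s in 𝓝[>] t, s ∈ S → s = t := by
      rcases ht.2.lt_or_eq with h | rfl
      · filter_upwards [(isRightSlope_rightSlope hf ⟨ht.1, h⟩).eventually] with s hs hS
        exact absurd (hs.2.eq.trans hs.1.eq.symm) hS.2
      · filter_upwards [self_mem_nhdsWithin] with s hs hS
        exact absurd hS.1.2 (not_lt.2 (le_of_lt hs))
    have hl : ∀ᶠ s in 𝓝[<] t, s ∈ S → s = t := by
      rcases ht.1.lt_or_eq with h | rfl
      · filter_upwards [(isLeftSlope_leftSlope hf ⟨h, ht.2⟩).eventually] with s hs hS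
        exact absurd (hs.2.eq.trans hs.1.eq.symm) hS.2
      · filter_upwards [self_mem_nhdsWithin] with s hs hS
        exact absurd hS.1.1 (not_lt.2 (le_of_lt hs))
    rw [eventually_nhdsWithin_iff] at hr hl
    filter_upwards [hr, hl] with s h1 h2 h3
    rcases lt_trichotomy s t with hs | rfl | hs
    · exact h2 hs h3
    · rfl
    · exact h1 hs h3
  obtain ⟨F, -, hF⟩ := isCompact_Icc.elim_nhds_subcover _ hU
  refine F.finite_toSet.subset fun s hs => ?_
  obtain ⟨t, ht, hst⟩ := mem_iUnion₂.1 (hF (Ioo_subset_Icc_self hs.1))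
  rw [show s = t from hst hs]; exact ht

/-- The function that vanishes up to `t` and has slope `1` from `t` on. -/
def hinge (t : ℝ) (s : ℝ) : ℝ := max (s - t) 0

theorem isRightSlope_hinge (t s : ℝ) : IsRightSlope (hinge t) s (if t ≤ s then 1 else 0) := by
  rw [IsRightSlope]
  split_ifs with h
  · filter_upwards [self_mem_nhdsWithin] with x hx
    have : s < x := hx
    rw [hinge, hinge, max_eq_left (by linarith), max_eq_left (by linarith)]; push_cast; ring
  · push Not at h
    filter_upwards [Ioo_mem_nhdsGT h] with x hx
    rw [hinge, hinge, max_eq_right (by linarith [hx.2]), max_eq_right (by linarith)]; simp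

theorem isLeftSlope_hinge (t s : ℝ) : IsLeftSlope (hinge t) s (if t < s then 1 else 0) := by
  rw [IsLeftSlope]
  split_ifs with h
  · filter_upwards [Ioo_mem_nhdsLT h] with x hx
    rw [hinge, hinge, max_eq_left (by linarith [hx.1]), max_eq_left (by linarith)]; push_cast; ring
  · push Not at h
    filter_upwards [self_mem_nhdsWithin] with x hx
    have : x < s := hx
    rw [hinge, hinge, max_eq_right (by linarith), max_eq_right (by linarith)]; simp

theorem IsRightSlope.zsmul {t : ℝ} {m : ℤ} (h : IsRightSlope f t m) (n : ℤ) :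
    IsRightSlope (n • f) t (n * m) := by
  filter_upwards [h] with s hs
  simp only [Pi.smul_apply, hs, zsmul_eq_mul]; push_cast; ring

theorem IsLeftSlope.zsmul {t : ℝ} {m : ℤ} (h : IsLeftSlope f t m) (n : ℤ) :
    IsLeftSlope (n • f) t (n * m) := by
  filter_upwards [h] with s hs
  simp only [Pi.smul_apply, hs, zsmul_eq_mul]; push_cast; ring

theorem hinge_mem_piecewiseLinear (t : ℝ) : hinge t ∈ piecewiseLinear L :=
  ⟨fun s _ => ⟨_, isRightSlope_hinge t s⟩, fun s _ => ⟨_, isLeftSlope_hinge t s⟩⟩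

/-- The bends of a piecewise linear function add up to its total change of slope. -/
theorem sum_leftSlope_sub_rightSlope (hL : 0 < L) (hf : f ∈ piecewiseLinear L) (S : Finset ℝ)
    (hS : ∀ t ∈ S, t ∈ Ioo 0 L) (h : ∀ t ∈ Ioo 0 L, leftSlope f t ≠ rightSlope f t → t ∈ S) :
    ∑ t ∈ S, (leftSlope f t - rightSlope f t) = rightSlope f 0 - leftSlope f L := by
  classical
  set c : ℝ → ℤ := fun t => leftSlope f t - rightSlope f t
  -- The hinge at `t` with coefficient `c t` cancels the bend of `f` at `t`, so `g` has a single
  -- slope. Comparing it at `0`, where no hinge is active, and at `L`, where all are, gives the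
  -- formula.
  set g : ℝ → ℝ := f + ∑ t ∈ S, c t • hinge t with hg
  have gR : ∀ s ∈ Ico 0 L,
      rightSlope g s = rightSlope f s + ∑ t ∈ S, c t * (if t ≤ s then 1 else 0) := fun s hs =>
    ((isRightSlope_rightSlope hf hs).add
      (IsRightSlope.sum S fun t _ => (isRightSlope_hinge t s).zsmul (c t))).eq
  have gL : ∀ s ∈ Ioc 0 L,
      leftSlope g s = leftSlope f s + ∑ t ∈ S, c t * (if t < s then 1 else 0) := fun s hs =>
    ((isLeftSlope_leftSlope hf hs).add
      (IsLeftSlope.sum S fun t _ => (isLeftSlope_hinge t s).zsmul (c t))).eq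
  have gm : g ∈ piecewiseLinear L := add_mem hf
    (sum_mem fun t _ => zsmul_mem (hinge_mem_piecewiseLinear t) _)
  have hz : ∀ s ∈ Ioo 0 L, leftSlope g s ≡ rightSlope g s [ZMOD 0] := by
    intro s hs
    rw [gR s ⟨hs.1.le, hs.2⟩, gL s ⟨hs.1, hs.2.le⟩]
    -- The two sums differ only in the term `t = s`; if `s` is not in `S`, then `c s = 0`.
    have : ∑ t ∈ S, c t * (if t ≤ s then 1 else 0) =
        ∑ t ∈ S, c t * (if t < s then 1 else 0) + c s := by
      rw [← sub_eq_iff_eq_add', ← Finset.sum_sub_distrib]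
      by_cases hsS : s ∈ S
      · rw [Finset.sum_eq_single_of_mem s hsS]
        · simp
        · intro t _ hts
          rcases lt_or_gt_of_ne hts with h | h
          · simp [h, h.le]
          · simp [h.not_gt, h.not_ge]
      · rw [show c s = 0 from by
          by_contra h0; exact hsS (h s hs (sub_ne_zero.1 h0))]
        refine Finset.sum_eq_zero fun t ht => ?_
        have hts : t ≠ s := fun h => hsS (h ▸ ht)
        rcases lt_or_gt_of_ne hts with h | h
        · simp [h, h.le]
        · simp [h.not_gt, h.not_ge]
    rw [this]
    have : leftSlope f s = rightSlope f s + c s := by simp [c]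
    rw [this]
    exact congrArg (· % 0) (by ring)
  have hfin : leftSlope g L = rightSlope g 0 := by
    simpa [Int.ModEq] using (slopes_modEq gm hz).2 L ⟨hL, le_rfl⟩
  rw [gL L ⟨hL, le_rfl⟩, gR 0 ⟨le_rfl, hL⟩] at hfin
  have e1 : ∑ t ∈ S, c t * (if t < L then 1 else 0) = ∑ t ∈ S, c t :=
    Finset.sum_congr rfl fun t ht => by simp [(hS t ht).2]
  have e2 : ∑ t ∈ S, c t * (if t ≤ 0 then 1 else 0) = 0 :=
    Finset.sum_eq_zero fun t ht => by simp [(hS t ht).1.not_ge]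
  rw [e1, e2] at hfin
  change ∑ t ∈ S, c t = _
  linarith

/-- The concave function with slopes `n` and `-n` that starts with value `a` at `0` and ends with
value `b` at `L`. -/
def tent (L a b : ℝ) (n : ℤ) (s : ℝ) : ℝ := min (a + n * s) (b + n * (L - s))

theorem isRightSlope_tent (L a b : ℝ) {n : ℤ} (hn : 0 ≤ n) (t : ℝ) :
    IsRightSlope (tent L a b n) t (if a + n * t < b + n * (L - t) then n else -n) := by
  have hn' : (0 : ℝ) ≤ n := by exact_mod_cast hn
  rw [IsRightSlope]
  split_ifs with h
  · have : ∀ᶠ s in 𝓝 t, a + n * s < b + n * (L - s) :=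
      ContinuousAt.eventually_lt (by fun_prop) (by fun_prop) h
    filter_upwards [nhdsWithin_le_nhds this] with s hs
    rw [tent, tent, min_eq_left h.le, min_eq_left hs.le]; ring
  · push Not at h
    filter_upwards [self_mem_nhdsWithin] with s hs
    have : (n : ℝ) * t ≤ n * s := mul_le_mul_of_nonneg_left (le_of_lt hs) hn'
    rw [tent, tent, min_eq_right h, min_eq_right (by linarith)]; push_cast; ring

theorem isLeftSlope_tent (L a b : ℝ) {n : ℤ} (hn : 0 ≤ n) (t : ℝ) :
    IsLeftSlope (tent L a b n) t (if a + n * t ≤ b + n * (L - t) then n else -n) := by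
  have hn' : (0 : ℝ) ≤ n := by exact_mod_cast hn
  rw [IsLeftSlope]
  split_ifs with h
  · filter_upwards [self_mem_nhdsWithin] with s hs
    have : (n : ℝ) * s ≤ n * t := mul_le_mul_of_nonneg_left (le_of_lt hs) hn'
    rw [tent, tent, min_eq_left h, min_eq_left (by linarith)]; ring
  · push Not at h
    have : ∀ᶠ s in 𝓝 t, b + n * (L - s) < a + n * s :=
      ContinuousAt.eventually_lt (by fun_prop) (by fun_prop) h
    filter_upwards [nhdsWithin_le_nhds this] with s hs
    rw [tent, tent, min_eq_right h.le, min_eq_right hs.le]; push_cast; ring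

theorem tent_mem_piecewiseLinear (M a b : ℝ) {n : ℤ} (hn : 0 ≤ n) :
    tent M a b n ∈ piecewiseLinear L :=
  ⟨fun t _ => ⟨_, isRightSlope_tent M a b hn t⟩, fun t _ => ⟨_, isLeftSlope_tent M a b hn t⟩⟩

/-- The straight interpolation need not have an integer slope, but a tent of integer slope at least
`|a - b| / L` passes through both end values. -/
theorem exists_piecewiseLinear_interpolation (hL : 0 < L) (a b : ℝ) :
    ∃ f ∈ piecewiseLinear L, f 0 = a ∧ f L = b := by
  obtain ⟨n, hn⟩ := exists_nat_ge (|a - b| / L)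
  rw [div_le_iff₀ hL] at hn
  obtain ⟨h1, h2⟩ := abs_le.1 hn
  refine ⟨tent L a b n, tent_mem_piecewiseLinear L a b (by positivity), ?_, ?_⟩
  · simp only [tent, Int.cast_natCast, mul_zero, add_zero, sub_zero]
    exact min_eq_left (by linarith)
  · simp only [tent, Int.cast_natCast, sub_self, mul_zero, add_zero]
    exact min_eq_right (by linarith)

/-- Values are arbitrary reals, so integrality of the slopes is all that halving can destroy. -/
theorem isRightSlope_half {t : ℝ} {m : ℤ} (h : IsRightSlope f t m) (hm : Even m) :
    IsRightSlope ((1 / 2 : ℝ) • f) t (m / 2) := by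
  obtain ⟨k, rfl⟩ := hm.two_dvd
  filter_upwards [h] with s hs
  simp only [Pi.smul_apply, hs, smul_eq_mul, Int.mul_ediv_cancel_left k two_ne_zero]
  push_cast; ring

theorem isLeftSlope_half {t : ℝ} {m : ℤ} (h : IsLeftSlope f t m) (hm : Even m) :
    IsLeftSlope ((1 / 2 : ℝ) • f) t (m / 2) := by
  obtain ⟨k, rfl⟩ := hm.two_dvd
  filter_upwards [h] with s hs
  simp only [Pi.smul_apply, hs, smul_eq_mul, Int.mul_ediv_cancel_left k two_ne_zero]
  push_cast; ring

theorem isFinalSlope_half {m : ℤ} (h : IsFinalSlope f m) (hm : Even m) :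
    IsFinalSlope ((1 / 2 : ℝ) • f) (m / 2) := by
  obtain ⟨k, rfl⟩ := hm.two_dvd
  obtain ⟨c, hc⟩ := h
  refine ⟨c / 2, ?_⟩
  filter_upwards [hc] with s hs
  simp only [Pi.smul_apply, hs, smul_eq_mul, Int.mul_ediv_cancel_left k two_ne_zero]
  push_cast; ring

end Interval

/-! ### Piecewise linear functions on a ray -/

section Ray

variable {f g : ℝ → ℝ}

theorem isFinalSlope_finalSlope (hf : f ∈ piecewiseLinearRay) :
    IsFinalSlope f (finalSlope f) := IsFinalSlope.exists_finalSlope hf.2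

theorem finalSlope_add (hf : f ∈ piecewiseLinearRay) (hg : g ∈ piecewiseLinearRay) :
    finalSlope (f + g) = finalSlope f + finalSlope g :=
  ((isFinalSlope_finalSlope hf).add (isFinalSlope_finalSlope hg)).eq

theorem IsFinalSlope.sum {ι : Type*} (s : Finset ι) {f : ι → ℝ → ℝ} {m : ι → ℤ}
    (h : ∀ i ∈ s, IsFinalSlope (f i) (m i)) : IsFinalSlope (∑ i ∈ s, f i) (∑ i ∈ s, m i) := by
  classical
  induction s using Finset.induction_on with
  | empty => simpa using IsFinalSlope.zero
  | insert a s ha ih =>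
    rw [Finset.sum_insert ha, Finset.sum_insert ha]
    exact (h a (Finset.mem_insert_self _ _)).add
      (ih fun i hi => h i (Finset.mem_insert_of_mem hi))

theorem finalSlope_sum {ι : Type*} (s : Finset ι) {f : ι → ℝ → ℝ}
    (hf : ∀ i ∈ s, f i ∈ piecewiseLinearRay) :
    finalSlope (∑ i ∈ s, f i) = ∑ i ∈ s, finalSlope (f i) :=
  (IsFinalSlope.sum s fun i hi => isFinalSlope_finalSlope (hf i hi)).eq

/-- Reduces questions about a ray to the bounded interval `[0, T]`. -/
theorem exists_forall_ge_slopes_eq_finalSlope (hf : f ∈ piecewiseLinearRay) :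
    ∃ T > 0, ∀ t ≥ T, rightSlope f t = finalSlope f ∧ leftSlope f t = finalSlope f := by
  obtain ⟨T, hT⟩ := eventually_atTop.1 (isFinalSlope_finalSlope hf).eventually
  refine ⟨max T 1, by positivity, fun t ht => ?_⟩
  have := hT t ((le_max_left _ _).trans ht)
  exact ⟨this.1.eq, this.2.eq⟩

theorem finite_breakpoints_ray (hf : f ∈ piecewiseLinearRay) :
    {t | 0 < t ∧ leftSlope f t ≠ rightSlope f t}.Finite := by
  obtain ⟨T, hT0, hT⟩ := exists_forall_ge_slopes_eq_finalSlope hf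
  refine (finite_breakpoints (hf.1 T)).subset fun t ht => ⟨⟨ht.1, ?_⟩, ht.2⟩
  by_contra h
  have := hT t (not_lt.1 h)
  exact ht.2 (this.2.trans this.1.symm)

/-- The final slope serves as reference because it is the order at the point at infinity, where the
theta equation determines its parity. -/
theorem slopes_modEq_ray (hf : f ∈ piecewiseLinearRay) {n : ℤ}
    (h : ∀ t > 0, leftSlope f t ≡ rightSlope f t [ZMOD n]) :
    (∀ t ≥ 0, rightSlope f t ≡ finalSlope f [ZMOD n]) ∧
      ∀ t > 0, leftSlope f t ≡ finalSlope f [ZMOD n] := by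
  obtain ⟨T, hT0, hT⟩ := exists_forall_ge_slopes_eq_finalSlope hf
  have key := fun L => slopes_modEq (hf.1 L) (n := n) fun t ht => h t ht.1
  have h0 : finalSlope f ≡ rightSlope f 0 [ZMOD n] := by
    rw [← (hT T le_rfl).2]; exact (key T).2 T ⟨hT0, le_rfl⟩
  exact ⟨fun t ht => ((key (t + 1)).1 t ⟨ht, by linarith⟩).trans h0.symm,
    fun t ht => ((key t).2 t ⟨ht, le_rfl⟩).trans h0.symm⟩

theorem affine_mem_piecewiseLinearRay (a : ℝ) (m : ℤ) :
    (fun s => a + m * s) ∈ piecewiseLinearRay :=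
  ⟨fun _ => ⟨fun t _ => ⟨m, IsRightSlope.affine a m t⟩, fun t _ => ⟨m, IsLeftSlope.affine a m t⟩⟩,
    m, IsFinalSlope.affine a m⟩

end Ray

/-! ### Weighted functions on a metric graph -/

variable (G : MetricGraph)

/-- Families of functions on the vertices, bounded edges and rays of a metric graph. -/
abbrev FunctionFamily : Type := (G.V → ℝ) × (G.E → ℝ → ℝ) × (G.R → ℝ → ℝ)

/-- Families of piecewise linear functions on the edges whose values at the ends of an edge are the
values at the end vertices times the weight of the edge. For weights `1` these are the rational
functions. -/
def weightedFunctions (wE : G.E → ℕ) (wR : G.R → ℕ) : AddSubgroup G.FunctionFamily where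
  carrier := {f | (∀ e, f.2.1 e ∈ piecewiseLinear (G.len e) ∧
      f.2.1 e 0 = wE e * f.1 (G.src e) ∧ f.2.1 e (G.len e) = wE e * f.1 (G.tgt e)) ∧
    ∀ r, f.2.2 r ∈ piecewiseLinearRay ∧ f.2.2 r 0 = wR r * f.1 (G.base r)}
  zero_mem' := ⟨fun e => ⟨zero_mem _, by simp, by simp⟩, fun r => ⟨zero_mem _, by simp⟩⟩
  add_mem' := by
    rintro f g ⟨hf, hf'⟩ ⟨hg, hg'⟩
    refine ⟨fun e => ⟨add_mem (hf e).1 (hg e).1, ?_, ?_⟩, fun r => ⟨add_mem (hf' r).1 (hg' r).1, ?_⟩⟩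
    · simp [(hf e).2.1, (hg e).2.1, mul_add]
    · simp [(hf e).2.2, (hg e).2.2, mul_add]
    · simp [(hf' r).2, (hg' r).2, mul_add]
  neg_mem' := by
    rintro f ⟨hf, hf'⟩
    refine ⟨fun e => ⟨neg_mem (hf e).1, ?_, ?_⟩, fun r => ⟨neg_mem (hf' r).1, ?_⟩⟩
    · simp [(hf e).2.1]
    · simp [(hf e).2.2]
    · simp [(hf' r).2]

variable {G}

/-- The slope of a family of functions along a half-edge, moving away from its origin. -/
def slopeAlong (f : G.FunctionFamily) : G.HalfEdge → ℤ :=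
  Sum.elim (Sum.elim (fun e => rightSlope (f.2.1 e) 0)
    (fun e => -leftSlope (f.2.1 e) (G.len e))) (fun r => rightSlope (f.2.2 r) 0)

/-- The order of a family of functions at a point: the sum of the incoming slopes. -/
def orderAt (f : G.FunctionFamily) : G.Point → ℤ
  | .vertex v => ∑ h ∈ G.star v, -slopeAlong f h
  | .edge e t _ => leftSlope (f.2.1 e) t - rightSlope (f.2.1 e) t
  | .ray r t _ => leftSlope (f.2.2 r) t - rightSlope (f.2.2 r) t
  | .infty r => finalSlope (f.2.2 r)

theorem mem_star {v : G.V} {h : G.HalfEdge} : h ∈ G.star v ↔ G.origin h = v := by simp [star]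

open Classical in
theorem sum_star {M : Type*} [AddCommMonoid M] (F : G.HalfEdge → M) (v : G.V) :
    ∑ h ∈ G.star v, F h = ∑ e, ((if G.src e = v then F (.inl (.inl e)) else 0) +
      (if G.tgt e = v then F (.inl (.inr e)) else 0)) +
      ∑ r, (if G.base r = v then F (.inr r) else 0) := by
  rw [star, Finset.sum_filter, Fintype.sum_sum_type, Fintype.sum_sum_type, Finset.sum_add_distrib]
  rfl

theorem sum_sum_star {M : Type*} [AddCommMonoid M] (F : G.HalfEdge → M) :
    ∑ v, ∑ h ∈ G.star v, F h = ∑ h, F h := by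
  classical
  rw [← Finset.sum_fiberwise Finset.univ G.origin F]
  refine Finset.sum_congr rfl fun v _ => ?_
  rw [star]

section Weighted

variable {wE : G.E → ℕ} {wR : G.R → ℕ} {f g : G.FunctionFamily}

theorem slopeAlong_add (hf : f ∈ G.weightedFunctions wE wR) (hg : g ∈ G.weightedFunctions wE wR)
    (h : G.HalfEdge) : slopeAlong (f + g) h = slopeAlong f h + slopeAlong g h := by
  rcases h with (e | e) | r
  · exact rightSlope_add (hf.1 e).1 (hg.1 e).1 ⟨le_rfl, G.len_pos e⟩
  · have := leftSlope_add (hf.1 e).1 (hg.1 e).1 (t := G.len e) ⟨G.len_pos e, le_rfl⟩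
    simp only [slopeAlong, Sum.elim_inl, Sum.elim_inr, Prod.snd_add, Prod.fst_add, Pi.add_apply,
      this]
    ring
  · exact rightSlope_add ((hf.2 r).1.1 1) ((hg.2 r).1.1 1) ⟨le_rfl, one_pos⟩

theorem orderAt_add (hf : f ∈ G.weightedFunctions wE wR) (hg : g ∈ G.weightedFunctions wE wR)
    (p : G.Point) : orderAt (f + g) p = orderAt f p + orderAt g p := by
  cases p with
  | vertex v =>
    simp only [orderAt, slopeAlong_add hf hg, ← Finset.sum_add_distrib, neg_add]
  | edge e t ht =>
    have h1 := rightSlope_add (hf.1 e).1 (hg.1 e).1 (t := t) ⟨ht.1.le, ht.2⟩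
    have h2 := leftSlope_add (hf.1 e).1 (hg.1 e).1 (t := t) ⟨ht.1, ht.2.le⟩
    simp only [orderAt, Prod.snd_add, Prod.fst_add, Pi.add_apply, h1, h2]; ring
  | ray r t ht =>
    have h1 := rightSlope_add ((hf.2 r).1.1 (t + 1)) ((hg.2 r).1.1 (t + 1)) (t := t)
      ⟨ht.le, by linarith⟩
    have h2 := leftSlope_add ((hf.2 r).1.1 t) ((hg.2 r).1.1 t) (t := t) ⟨ht, le_rfl⟩
    simp only [orderAt, Prod.snd_add, Pi.add_apply, h1, h2]; ring
  | infty r => exact finalSlope_add (hf.2 r).1 (hg.2 r).1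

theorem slopeAlong_sub (hf : f ∈ G.weightedFunctions wE wR) (hg : g ∈ G.weightedFunctions wE wR)
    (h : G.HalfEdge) : slopeAlong (f - g) h = slopeAlong f h - slopeAlong g h := by
  have := slopeAlong_add (sub_mem hf hg) hg h
  rw [sub_add_cancel] at this
  linarith

theorem orderAt_sub (hf : f ∈ G.weightedFunctions wE wR) (hg : g ∈ G.weightedFunctions wE wR)
    (p : G.Point) : orderAt (f - g) p = orderAt f p - orderAt g p := by
  have := orderAt_add (sub_mem hf hg) hg p
  rw [sub_add_cancel] at this
  linarith

/-- A weighted function has non-zero order at finitely many points only. -/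
theorem exists_divisor_eq_orderAt (hf : f ∈ G.weightedFunctions wE wR) :
    ∃ D : G.Divisor, ∀ p, D p = orderAt f p := by
  -- Apart from vertices and points at infinity, only bends have non-zero order.
  have hfin : {p | orderAt f p ≠ 0}.Finite := by
    have hE := fun e => (finite_breakpoints (hf.1 e).1).to_subtype
    have hR := fun r => (finite_breakpoints_ray (hf.2 r).1).to_subtype
    refine (((finite_range (Point.vertex (G := G))).union
      (finite_range (Point.infty (G := G)))).union
      ((finite_iUnion fun e => finite_range fun x :
        {t ∈ Ioo 0 (G.len e) | leftSlope (f.2.1 e) t ≠ rightSlope (f.2.1 e) t} =>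
          Point.edge e x x.2.1).union
      (finite_iUnion fun r => finite_range fun x :
        {t | 0 < t ∧ leftSlope (f.2.2 r) t ≠ rightSlope (f.2.2 r) t} =>
          Point.ray r x x.2.1))).subset fun p hp => ?_
    cases p with
    | vertex v => exact Or.inl (Or.inl ⟨v, rfl⟩)
    | edge e t ht => exact Or.inr (Or.inl (mem_iUnion.2 ⟨e, ⟨t, ht, sub_ne_zero.1 hp⟩, rfl⟩))
    | ray r t ht => exact Or.inr (Or.inr (mem_iUnion.2 ⟨r, ⟨t, ht, sub_ne_zero.1 hp⟩, rfl⟩))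
    | infty r => exact Or.inl (Or.inr ⟨r, rfl⟩)
  exact ⟨Finsupp.ofSupportFinite (orderAt f) hfin, fun p => rfl⟩

/-- A weighted function without zeros and poles has slope zero along all edges. -/
theorem rightSlope_eq_zero_of_orderAt_eq_zero (hwE : ∀ e, 0 < wE e)
    (hf : f ∈ G.weightedFunctions wE wR) (h : ∀ p, orderAt f p = 0) (e : G.E) :
    rightSlope (f.2.1 e) 0 = 0 := by
  -- Without bends, congruence modulo `0` yields a single slope on every edge and ray.
  have hE := fun e => slopes_modEq (hf.1 e).1 (n := 0) fun t ht =>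
    congrArg (· % 0) (sub_eq_zero.1 (h (.edge e t ht)))
  have hR := fun r => slopes_modEq_ray (hf.2 r).1 (n := 0) fun t ht =>
    congrArg (· % 0) (sub_eq_zero.1 (h (.ray r t ht)))
  simp only [Int.ModEq, Int.emod_zero] at hE hR
  have hdiff : ∀ e, (wE e : ℝ) * (f.1 (G.tgt e) - f.1 (G.src e)) =
      rightSlope (f.2.1 e) 0 * G.len e := by
    intro e
    have := eq_affine_of_rightSlope_eq (hf.1 e).1 (hE e).1 (G.len e) ⟨(G.len_pos e).le, le_rfl⟩
    rw [(hf.1 e).2.1, (hf.1 e).2.2] at this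
    linarith
  -- Energy argument: the sum of `f(v) · ord_v f` over the vertices vanishes. Regrouped by edges, it
  -- is minus a sum of non-negative terms `slope² · length / weight`, so every slope is zero.
  have hzero : ∑ x : G.HalfEdge, f.1 (G.origin x) * (slopeAlong f x : ℝ) = 0 := by
    rw [← sum_sum_star]
    refine Finset.sum_eq_zero fun v _ => ?_
    have h1 : ∑ x ∈ G.star v, -slopeAlong f x = 0 := h (.vertex v)
    rw [Finset.sum_neg_distrib, neg_eq_zero] at h1
    rw [Finset.sum_congr rfl (g := fun x => f.1 v * (slopeAlong f x : ℝ)) fun x hx => by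
      rw [mem_star.1 hx], ← Finset.mul_sum, ← Int.cast_sum, h1]
    simp
  rw [Fintype.sum_sum_type, Fintype.sum_sum_type, ← Finset.sum_add_distrib] at hzero
  -- Rays contribute nothing: their slope is the final slope, which is the order at infinity.
  have hr : ∑ r : G.R, f.1 (G.origin (.inr r)) * (slopeAlong f (.inr r) : ℝ) = 0 := by
    refine Finset.sum_eq_zero fun r _ => ?_
    have h1 : rightSlope (f.2.2 r) 0 = 0 := ((hR r).1 0 le_rfl).trans (h (.infty r))
    simp [slopeAlong, h1]
  rw [hr, add_zero] at hzero
  have hterm : ∀ e, f.1 (G.origin (.inl (.inl e))) * (slopeAlong f (.inl (.inl e)) : ℝ) +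
      f.1 (G.origin (.inl (.inr e))) * (slopeAlong f (.inl (.inr e)) : ℝ) =
      -((rightSlope (f.2.1 e) 0 : ℝ) ^ 2 * G.len e / wE e) := by
    intro e
    have hw : (wE e : ℝ) ≠ 0 := by exact_mod_cast (hwE e).ne'
    have h1 : leftSlope (f.2.1 e) (G.len e) = rightSlope (f.2.1 e) 0 :=
      (hE e).2 _ ⟨G.len_pos e, le_rfl⟩
    simp only [origin, slopeAlong, Sum.elim_inl, Sum.elim_inr, h1]
    rw [eq_neg_iff_add_eq_zero, div_eq_mul_inv, pow_two, mul_assoc _ _ (G.len e), ← hdiff e]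
    field_simp
    push_cast
    ring
  rw [Finset.sum_congr rfl fun e _ => hterm e, Finset.sum_neg_distrib, neg_eq_zero,
    Finset.sum_eq_zero_iff_of_nonneg fun e _ => by
      have := (G.len_pos e).le
      positivity] at hzero
  have h1 := hzero e (Finset.mem_univ e)
  have hw : (wE e : ℝ) ≠ 0 := by exact_mod_cast (hwE e).ne'
  have hl := (G.len_pos e).ne'
  simpa [hw, hl] using h1

/-- The conditions at the ends of edges are linear over the reals and survive halving; evenness of
all slopes keeps the slopes integral. -/
theorem half_mem_weightedFunctions (hf : f ∈ G.weightedFunctions wE wR)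
    (hE : ∀ e, (∀ t ∈ Ico 0 (G.len e), Even (rightSlope (f.2.1 e) t)) ∧
      ∀ t ∈ Ioc 0 (G.len e), Even (leftSlope (f.2.1 e) t))
    (hR : ∀ r, (∀ t ≥ 0, Even (rightSlope (f.2.2 r) t)) ∧
      (∀ t > 0, Even (leftSlope (f.2.2 r) t)) ∧ Even (finalSlope (f.2.2 r))) :
    (1 / 2 : ℝ) • f ∈ G.weightedFunctions wE wR ∧
      ∀ p, 2 * orderAt ((1 / 2 : ℝ) • f) p = orderAt f p := by
  have er : ∀ e, ∀ t ∈ Ico 0 (G.len e), IsRightSlope ((1 / 2 : ℝ) • f.2.1 e) t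
      (rightSlope (f.2.1 e) t / 2) := fun e t ht =>
    isRightSlope_half (isRightSlope_rightSlope (hf.1 e).1 ht) ((hE e).1 t ht)
  have el : ∀ e, ∀ t ∈ Ioc 0 (G.len e), IsLeftSlope ((1 / 2 : ℝ) • f.2.1 e) t
      (leftSlope (f.2.1 e) t / 2) := fun e t ht =>
    isLeftSlope_half (isLeftSlope_leftSlope (hf.1 e).1 ht) ((hE e).2 t ht)
  have rr : ∀ r, ∀ t : ℝ, 0 ≤ t → IsRightSlope ((1 / 2 : ℝ) • f.2.2 r) t
      (rightSlope (f.2.2 r) t / 2) := fun r t ht =>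
    isRightSlope_half (isRightSlope_rightSlope ((hf.2 r).1.1 (t + 1)) ⟨ht, by linarith⟩)
      ((hR r).1 t ht)
  have rl : ∀ r, ∀ t : ℝ, 0 < t → IsLeftSlope ((1 / 2 : ℝ) • f.2.2 r) t
      (leftSlope (f.2.2 r) t / 2) := fun r t ht =>
    isLeftSlope_half (isLeftSlope_leftSlope ((hf.2 r).1.1 t) ⟨ht, le_rfl⟩) ((hR r).2.1 t ht)
  have rf : ∀ r, IsFinalSlope ((1 / 2 : ℝ) • f.2.2 r) (finalSlope (f.2.2 r) / 2) := fun r =>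
    isFinalSlope_half (isFinalSlope_finalSlope (hf.2 r).1) (hR r).2.2
  refine ⟨⟨fun e => ⟨⟨fun t ht => ⟨_, er e t ht⟩, fun t ht => ⟨_, el e t ht⟩⟩, ?_, ?_⟩,
    fun r => ⟨⟨fun L => ⟨fun t ht => ⟨_, rr r t ht.1⟩, fun t ht => ⟨_, rl r t ht.1⟩⟩, _, rf r⟩,
      ?_⟩⟩, fun p => ?_⟩
  · simp only [Prod.smul_snd, Prod.smul_fst, Pi.smul_apply, (hf.1 e).2.1, smul_eq_mul]; ring
  · simp only [Prod.smul_snd, Prod.smul_fst, Pi.smul_apply, (hf.1 e).2.2, smul_eq_mul]; ring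
  · simp only [Prod.smul_snd, Prod.smul_fst, Pi.smul_apply, (hf.2 r).2, smul_eq_mul]; ring
  cases p with
  | vertex v =>
    simp only [orderAt, Finset.mul_sum]
    refine Finset.sum_congr rfl fun h _ => ?_
    rcases h with (e | e) | r
    · simp only [slopeAlong, Sum.elim_inl, Prod.smul_snd, Prod.smul_fst, Pi.smul_apply,
        (er e 0 ⟨le_rfl, G.len_pos e⟩).eq]
      have := Int.two_mul_ediv_two_of_even ((hE e).1 0 ⟨le_rfl, G.len_pos e⟩)
      linarith
    · simp only [slopeAlong, Sum.elim_inl, Sum.elim_inr, Prod.smul_snd, Prod.smul_fst,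
        Pi.smul_apply, (el e _ ⟨G.len_pos e, le_rfl⟩).eq]
      have := Int.two_mul_ediv_two_of_even ((hE e).2 _ ⟨G.len_pos e, le_rfl⟩)
      linarith
    · simp only [slopeAlong, Sum.elim_inr, Prod.smul_snd, Pi.smul_apply, (rr r 0 le_rfl).eq]
      have := Int.two_mul_ediv_two_of_even ((hR r).1 0 le_rfl)
      linarith
  | edge e t ht =>
    simp only [orderAt, Prod.smul_snd, Prod.smul_fst, Pi.smul_apply,
      (er e t ⟨ht.1.le, ht.2⟩).eq, (el e t ⟨ht.1, ht.2.le⟩).eq]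
    have h1 := Int.two_mul_ediv_two_of_even ((hE e).1 t ⟨ht.1.le, ht.2⟩)
    have h2 := Int.two_mul_ediv_two_of_even ((hE e).2 t ⟨ht.1, ht.2.le⟩)
    linarith
  | ray r t ht =>
    simp only [orderAt, Prod.smul_snd, Pi.smul_apply, (rr r t ht.le).eq, (rl r t ht).eq]
    have h1 := Int.two_mul_ediv_two_of_even ((hR r).1 t ht.le)
    have h2 := Int.two_mul_ediv_two_of_even ((hR r).2.1 t ht)
    linarith
  | infty r =>
    simp only [orderAt, Prod.smul_snd, Pi.smul_apply, (rf r).eq]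
    exact Int.two_mul_ediv_two_of_even (hR r).2.2

end Weighted

variable (G)

/-! ### Cycles modulo two -/

open Classical in
/-- The boundary map from `1`-chains to `0`-chains with coefficients modulo `2`. -/
def boundary : (G.E → ZMod 2) →ₗ[ZMod 2] (G.V → ZMod 2) where
  toFun γ v := ∑ e, ((if G.src e = v then γ e else 0) + if G.tgt e = v then γ e else 0)
  map_add' γ δ := by
    ext v
    simp only [Pi.add_apply, ← Finset.sum_add_distrib]
    refine Finset.sum_congr rfl fun e _ => ?_
    split_ifs <;> ring
  map_smul' c γ := by
    ext v
    simp only [Pi.smul_apply, smul_eq_mul, Finset.mul_sum, RingHom.id_apply]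
    refine Finset.sum_congr rfl fun e _ => ?_
    split_ifs <;> ring

open Classical in
theorem boundary_apply (γ : G.E → ZMod 2) (v : G.V) : G.boundary γ v =
    ∑ e, ((if G.src e = v then γ e else 0) + if G.tgt e = v then γ e else 0) := rfl

/-- The transpose of the incidence matrix is the coboundary `x ↦ x (src e) + x (tgt e)`. By
connectedness its kernel consists of the constants, and a matrix and its transpose have the same
rank. -/
theorem finrank_range_boundary_add_one :
    Module.finrank (ZMod 2) (LinearMap.range G.boundary) + 1 = Fintype.card G.V := by
  classical
  let B : Matrix G.V G.E (ZMod 2) := Matrix.of fun v e =>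
    (if G.src e = v then 1 else 0) + if G.tgt e = v then 1 else 0
  have hB : G.boundary = B.mulVecLin := by
    ext γ v
    simp only [LinearMap.comp_apply, boundary_apply, Matrix.mulVecLin_apply, Matrix.mulVec,
      dotProduct, B, Matrix.of_apply, add_mul, ite_mul, one_mul, zero_mul]
  have hT : ∀ (x : G.V → ZMod 2) e, B.transpose.mulVecLin x e = x (G.src e) + x (G.tgt e) := by
    intro x e
    simp only [Matrix.mulVecLin_apply, Matrix.mulVec, dotProduct, Matrix.transpose_apply, B,
      Matrix.of_apply, add_mul, ite_mul, one_mul, zero_mul, Finset.sum_add_distrib]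
    simp
  have hker : LinearMap.ker B.transpose.mulVecLin = Submodule.span (ZMod 2) {1} := by
    ext x
    rw [LinearMap.mem_ker, Submodule.mem_span_singleton]
    constructor
    · intro hx
      obtain ⟨v₀⟩ := G.nonempty
      refine ⟨x v₀, funext fun v => ?_⟩
      have : ∀ u v, Relation.EqvGen (fun a b => ∃ e, G.src e = a ∧ G.tgt e = b) u v →
          x u = x v := by
        intro u v h
        induction h with
        | rel a b h =>
          obtain ⟨e, rfl, rfl⟩ := h
          have := congrFun hx e
          rw [hT] at this
          exact CharTwo.add_eq_zero.1 this
        | refl a => rfl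
        | symm a b _ ih => exact ih.symm
        | trans a b c _ _ ih ih' => exact ih.trans ih'
      simpa using this v₀ v (G.connected v₀ v)
    · rintro ⟨c, rfl⟩
      ext e
      rw [hT]
      simp [CharTwo.add_self_eq_zero]
  have h2 := LinearMap.finrank_range_add_finrank_ker B.transpose.mulVecLin
  have h3 : Module.finrank (ZMod 2) (LinearMap.range B.transpose.mulVecLin) =
      Module.finrank (ZMod 2) (LinearMap.range B.mulVecLin) := B.rank_transpose
  have hne : (1 : G.V → ZMod 2) ≠ 0 := by
    obtain ⟨v₀⟩ := G.nonempty
    exact fun h => one_ne_zero (congrFun h v₀)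
  rw [hker, finrank_span_singleton hne, h3, Module.finrank_fintype_fun_eq_card] at h2
  rw [hB, h2]

theorem finrank_range_add_finrank_ker_boundary :
    Module.finrank (ZMod 2) (LinearMap.range G.boundary) +
      Module.finrank (ZMod 2) (LinearMap.ker G.boundary) = Fintype.card G.E := by
  rw [LinearMap.finrank_range_add_finrank_ker, Module.finrank_fintype_fun_eq_card]

/-- Guarantees that the truncated subtraction in `genus` is a true one. -/
theorem card_vertices_le : Fintype.card G.V ≤ Fintype.card G.E + 1 := by
  have := G.finrank_range_boundary_add_one
  have := G.finrank_range_add_finrank_ker_boundary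
  omega

theorem finrank_ker_boundary :
    Module.finrank (ZMod 2) (LinearMap.ker G.boundary) = G.genus := by
  have := G.finrank_range_boundary_add_one
  have := G.finrank_range_add_finrank_ker_boundary
  rw [genus]
  omega

theorem ncard_ker_boundary : (LinearMap.ker G.boundary : Set (G.E → ZMod 2)).ncard =
    2 ^ G.genus := by
  classical
  rw [← Nat.card_coe_set_eq]
  have := Module.natCard_eq_pow_finrank (K := ZMod 2) (V := LinearMap.ker G.boundary)
  rw [finrank_ker_boundary, Nat.card_zmod] at this
  exact this

variable {G}

/-! ### Theta characteristics and parities of slopes -/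

theorem intCast_zmod_two_of_even {n : ℤ} (h : Even n) : (n : ZMod 2) = 0 := by
  obtain ⟨k, rfl⟩ := h
  push_cast
  exact CharTwo.add_self_eq_zero _

theorem even_of_intCast_zmod_two {n : ℤ} (h : (n : ZMod 2) = 0) : Even n :=
  even_iff_two_dvd.2 ((ZMod.intCast_zmod_eq_zero_iff_dvd n 2).1 h)

/-- The divisor `K` has, modulo two, the number of outgoing edges, counted with weights, as
coefficient at every point. -/
structure IsCanonicalModTwo (wE : G.E → ℕ) (wR : G.R → ℕ) (K : G.Divisor) : Prop where
  vertex : ∀ v, Even (K (.vertex v) + ∑ h ∈ G.star v, ((Sum.elim (Sum.elim wE wE) wR h : ℕ) : ℤ))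
  edge : ∀ e t ht, Even (K (.edge e t ht))
  ray : ∀ r t ht, Even (K (.ray r t ht))
  infty : ∀ r, Even (K (.infty r) + wR r)

/-- The weighted function `f` witnesses that `2θ` is linearly equivalent to `K`. -/
structure IsThetaFunction (wE : G.E → ℕ) (wR : G.R → ℕ) (K θ : G.Divisor)
    (f : G.FunctionFamily) : Prop where
  mem : f ∈ G.weightedFunctions wE wR
  eq : ∀ p, 2 * θ p = K p + orderAt f p

/-- The parity, along every bounded edge, of the slope of `f` plus the weight of the edge. -/
def slopeParity (wE : G.E → ℕ) (f : G.FunctionFamily) (e : G.E) : ZMod 2 :=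
  wE e + rightSlope (f.2.1 e) 0

section Theta

variable {wE : G.E → ℕ} {wR : G.R → ℕ} {K θ θ' : G.Divisor} {f f' : G.FunctionFamily}

namespace IsThetaFunction

/-- At interior points both `2θ` and `K` are even, so all bends of `f` are even. -/
theorem slopes_edge (hK : IsCanonicalModTwo wE wR K) (hf : IsThetaFunction wE wR K θ f) (e : G.E) :
    (∀ t ∈ Ico 0 (G.len e), rightSlope (f.2.1 e) t ≡ rightSlope (f.2.1 e) 0 [ZMOD 2]) ∧
      ∀ t ∈ Ioc 0 (G.len e), leftSlope (f.2.1 e) t ≡ rightSlope (f.2.1 e) 0 [ZMOD 2] := by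
  refine slopes_modEq (hf.mem.1 e).1 fun t ht => ?_
  have h1 : _ = _ + (leftSlope (f.2.1 e) t - rightSlope (f.2.1 e) t) := hf.eq (.edge e t ht)
  have h2 := hK.edge e t ht
  rw [Int.ModEq]
  rw [Int.even_iff] at h2
  omega

/-- The equation at the point at infinity fixes the parity of the final slope, and even bends carry
it along the whole ray. -/
theorem slopes_ray (hK : IsCanonicalModTwo wE wR K) (hf : IsThetaFunction wE wR K θ f) (r : G.R) :
    (∀ t ≥ 0, rightSlope (f.2.2 r) t ≡ wR r [ZMOD 2]) ∧
      (∀ t > 0, leftSlope (f.2.2 r) t ≡ wR r [ZMOD 2]) ∧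
      finalSlope (f.2.2 r) ≡ wR r [ZMOD 2] := by
  have h0 : finalSlope (f.2.2 r) ≡ wR r [ZMOD 2] := by
    have h1 : _ = _ + finalSlope (f.2.2 r) := hf.eq (.infty r)
    have h2 := hK.infty r
    rw [Int.ModEq]
    rw [Int.even_iff] at h2
    omega
  have := slopes_modEq_ray (hf.mem.2 r).1 (n := 2) fun t ht => by
    have h1 : _ = _ + (leftSlope (f.2.2 r) t - rightSlope (f.2.2 r) t) := hf.eq (.ray r t ht)
    have h2 := hK.ray r t ht
    rw [Int.ModEq]
    rw [Int.even_iff] at h2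
    omega
  exact ⟨fun t ht => (this.1 t ht).trans h0, fun t ht => (this.2 t ht).trans h0, h0⟩

/-- At a vertex, `K` has the parity of the weighted valency, so the equation says that weight plus
slope, summed over the half-edges, is even. Rays drop out by `slopes_ray`, and the two ends of an
edge carry the same parity by `slopes_edge`, signs being irrelevant modulo 2. -/
theorem slopeParity_mem_ker (hK : IsCanonicalModTwo wE wR K) (hf : IsThetaFunction wE wR K θ f) :
    slopeParity wE f ∈ LinearMap.ker G.boundary := by
  rw [LinearMap.mem_ker]
  ext v
  have cast_eq : ∀ a b : ℤ, a ≡ b [ZMOD 2] → (a : ZMod 2) = b := fun a b h =>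
    (ZMod.intCast_eq_intCast_iff a b 2).2 h
  have h1 := intCast_zmod_two_of_even (hK.vertex v)
  have h2 : ((2 * θ (.vertex v) : ℤ) : ZMod 2) = 0 := intCast_zmod_two_of_even (even_two_mul _)
  rw [hf.eq] at h2
  simp only [orderAt] at h2
  push_cast at h1 h2
  have h3 : ∑ h ∈ G.star v, (((Sum.elim (Sum.elim wE wE) wR h : ℕ) : ZMod 2) + slopeAlong f h) = 0 := by
    rw [Finset.sum_add_distrib]
    rw [Finset.sum_neg_distrib] at h2
    have : (∑ h ∈ G.star v, (slopeAlong f h : ZMod 2)) = K (.vertex v) := by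
      linear_combination -h2
    rw [this]
    linear_combination h1
  rw [sum_star] at h3
  rw [boundary_apply, Pi.zero_apply]
  refine Eq.trans ?_ h3
  rw [Finset.sum_eq_zero (s := Finset.univ (α := G.R)), add_zero]
  · refine Finset.sum_congr rfl fun e _ => ?_
    congr 1
    congr 1
    simp only [slopeParity, slopeAlong, Sum.elim_inl, Sum.elim_inr]
    rw [← cast_eq _ _ ((hf.slopes_edge hK e).2 _ ⟨G.len_pos e, le_rfl⟩)]
    push_cast
    rw [CharTwo.neg_eq]
  · intro r _
    have := cast_eq _ _ ((hf.slopes_ray hK r).1 0 le_rfl)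
    simp only [slopeAlong, Sum.elim_inr, this]
    push_cast
    rw [CharTwo.add_self_eq_zero, ite_self]

/-- The function `f - f' - 2h` has no zeros or poles, hence slope zero at the source of every
bounded edge, so `f` and `f'` have slopes of equal parity there. -/
theorem slopeParity_congr (hwE : ∀ e, 0 < wE e) (hf : IsThetaFunction wE wR K θ f)
    (hf' : IsThetaFunction wE wR K θ' f') {h : G.FunctionFamily}
    (hh : h ∈ G.weightedFunctions wE wR) (hD : ∀ p, θ p - θ' p = orderAt h p) :
    slopeParity wE f = slopeParity wE f' := by
  ext e
  have h1 := rightSlope_eq_zero_of_orderAt_eq_zero hwE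
    (sub_mem (sub_mem hf.mem hf'.mem) (add_mem hh hh)) (fun p => by
      rw [orderAt_sub (sub_mem hf.mem hf'.mem) (add_mem hh hh), orderAt_sub hf.mem hf'.mem,
        orderAt_add hh hh, ← hD]
      linarith [hf.eq p, hf'.eq p]) e
  have h2 := slopeAlong_sub (sub_mem hf.mem hf'.mem) (add_mem hh hh) (.inl (.inl e))
  rw [slopeAlong_sub hf.mem hf'.mem, slopeAlong_add hh hh] at h2
  have h3 := h1.symm.trans h2
  have h4 : rightSlope (f.2.1 e) 0 = rightSlope (f'.2.1 e) 0 + 2 * rightSlope (h.2.1 e) 0 := by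
    simp only [slopeAlong, Sum.elim_inl] at h3
    linarith
  rw [slopeParity, slopeParity, h4]
  push_cast
  rw [show (2 : ZMod 2) = 0 from rfl]
  ring

/-- The divisor of `f - f'` is `2(θ - θ')` and all slopes of `f - f'` are even, so `(f - f') / 2` is
the required function. -/
theorem exists_orderAt_eq_sub (hf : IsThetaFunction wE wR K θ f)
    (hf' : IsThetaFunction wE wR K θ' f') (h : slopeParity wE f = slopeParity wE f') :
    ∃ g ∈ G.weightedFunctions wE wR, ∀ p, θ p - θ' p = orderAt g p := by
  have hs : ∀ x, slopeAlong (f - f') x = slopeAlong f x - slopeAlong f' x :=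
    slopeAlong_sub hf.mem hf'.mem
  have ho := orderAt_sub hf.mem hf'.mem
  have hsub : f - f' ∈ G.weightedFunctions wE wR := sub_mem hf.mem hf'.mem
  have hord : ∀ p, orderAt (f - f') p = 2 * (θ p - θ' p) := fun p => by
    rw [ho]; linarith [hf.eq p, hf'.eq p]
  have h0 : ∀ e, Even (rightSlope ((f - f').2.1 e) 0) := by
    intro e
    have h1 : rightSlope ((f - f').2.1 e) 0 = _ := hs (.inl (.inl e))
    rw [h1]
    apply even_of_intCast_zmod_two
    have h2 := congrFun h e
    simp only [slopeParity] at h2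
    simp only [slopeAlong, Sum.elim_inl]
    push_cast
    rw [sub_eq_zero]
    exact add_left_cancel h2
  have hE := fun e => slopes_modEq (hsub.1 e).1 (n := 2) fun t ht => by
    have h1 : leftSlope ((f - f').2.1 e) t - rightSlope ((f - f').2.1 e) t = _ :=
      hord (.edge e t ht)
    rw [Int.ModEq]; omega
  have hR := fun r => slopes_modEq_ray (hsub.2 r).1 (n := 2) fun t ht => by
    have h1 : leftSlope ((f - f').2.2 r) t - rightSlope ((f - f').2.2 r) t = _ :=
      hord (.ray r t ht)
    rw [Int.ModEq]; omega
  have hF : ∀ r, Even (finalSlope ((f - f').2.2 r)) := fun r => by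
    have h1 : finalSlope ((f - f').2.2 r) = _ := hord (.infty r)
    rw [h1]; exact even_two_mul _
  have even_congr : ∀ a b : ℤ, a ≡ b [ZMOD 2] → Even b → Even a := fun a b hab hb => by
    rw [Int.even_iff] at hb ⊢; rw [← hb]; exact hab
  obtain ⟨hm, hg⟩ := half_mem_weightedFunctions hsub
    (fun e => ⟨fun t ht => even_congr _ _ ((hE e).1 t ht) (h0 e),
      fun t ht => even_congr _ _ ((hE e).2 t ht) (h0 e)⟩)
    (fun r => ⟨fun t ht => even_congr _ _ ((hR r).1 t ht) (hF r),
      fun t ht => even_congr _ _ ((hR r).2 t ht) (hF r), hF r⟩)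
  exact ⟨_, hm, fun p => by linarith [hg p, hord p]⟩

end IsThetaFunction

variable {N : AddSubgroup G.Divisor}

theorem mk_two_smul_eq_iff
    (hN : ∀ D, D ∈ N ↔ ∃ f ∈ G.weightedFunctions wE wR, ∀ p, D p = orderAt f p) :
    ((2 • θ : G.Divisor) : G.Divisor ⧸ N) = (K : G.Divisor ⧸ N) ↔
      ∃ f, IsThetaFunction wE wR K θ f := by
  rw [QuotientAddGroup.eq_iff_sub_mem, hN]
  constructor
  · rintro ⟨f, hf, h⟩
    refine ⟨f, hf, fun p => ?_⟩
    rw [← h p]; simp [two_mul, two_smul]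
  · rintro ⟨f, hf, h⟩
    refine ⟨f, hf, fun p => ?_⟩
    have := h p
    simp only [two_smul, Finsupp.coe_sub, Finsupp.coe_add, Pi.sub_apply, Pi.add_apply]
    linarith

/-- A theta characteristic class is determined by a cycle modulo two, the parities of the slopes
of the functions that witness it. -/
theorem exists_slopeParity_map (hwE : ∀ e, 0 < wE e) (hK : IsCanonicalModTwo wE wR K)
    (hN : ∀ D, D ∈ N ↔ ∃ f ∈ G.weightedFunctions wE wR, ∀ p, D p = orderAt f p) :
    ∃ Φ : G.Divisor ⧸ N → G.E → ZMod 2,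
      (∀ θ f, IsThetaFunction wE wR K θ f → Φ θ = slopeParity wE f) ∧
      InjOn Φ {c | ∃ θ : G.Divisor, (θ : G.Divisor ⧸ N) = c ∧
        ((2 • θ : G.Divisor) : G.Divisor ⧸ N) = K} ∧
      MapsTo Φ {c | ∃ θ : G.Divisor, (θ : G.Divisor ⧸ N) = c ∧
        ((2 • θ : G.Divisor) : G.Divisor ⧸ N) = K} (LinearMap.ker G.boundary) := by
  classical
  -- `P c γ` says that some representative and witness for `c` have parity `γ`. By
  -- `slopeParity_congr` such a `γ` is unique; classes without one are sent to the default value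
  -- `0`.
  let P : G.Divisor ⧸ N → (G.E → ZMod 2) → Prop := fun c γ => ∃ (θ : G.Divisor)
    (f : G.FunctionFamily), (θ : G.Divisor ⧸ N) = c ∧ IsThetaFunction wE wR K θ f ∧
      slopeParity wE f = γ
  have key : ∀ θ f, IsThetaFunction wE wR K θ f →
      (if h : ∃ γ, P θ γ then h.choose else 0) = slopeParity wE f := by
    intro θ f hf
    have hex : ∃ γ, P θ γ := ⟨_, θ, f, rfl, hf, rfl⟩
    rw [dif_pos hex]
    obtain ⟨θ', f', h1, h2, h3⟩ := hex.choose_spec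
    rw [← h3]
    obtain ⟨g, hg, hg'⟩ := (hN _).1 (QuotientAddGroup.eq_iff_sub_mem.1 h1)
    exact h2.slopeParity_congr hwE hf hg hg'
  refine ⟨fun c => if h : ∃ γ, P c γ then h.choose else 0, key, ?_, ?_⟩
  · rintro _ ⟨θ, rfl, hθ⟩ _ ⟨θ', rfl, hθ'⟩ h
    obtain ⟨f, hf⟩ := (mk_two_smul_eq_iff hN).1 hθ
    obtain ⟨f', hf'⟩ := (mk_two_smul_eq_iff hN).1 hθ'
    have h' := (key _ _ hf).symm.trans (h.trans (key _ _ hf'))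
    rw [QuotientAddGroup.eq_iff_sub_mem, hN]
    exact hf.exists_orderAt_eq_sub hf' h'
  · rintro _ ⟨θ, rfl, hθ⟩
    obtain ⟨f, hf⟩ := (mk_two_smul_eq_iff hN).1 hθ
    change (if h : ∃ γ, P θ γ then h.choose else 0) ∈ _
    rw [key _ _ hf]
    exact hf.slopeParity_mem_ker hK

end Theta

/-! ### Theta characteristics on a metric graph -/

/-- With all weights 1 the end conditions of a weighted function are continuity at the vertices.
This brings the metric graph under the general theory. -/
theorem mem_principal_iff (D : G.Divisor) : D ∈ G.principal ↔
    ∃ f ∈ G.weightedFunctions (fun _ => 1) (fun _ => 1), ∀ p, D p = orderAt f p := by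
  constructor
  · rintro ⟨f, hf⟩
    refine ⟨(f.atVertex, f.onEdge, f.onRay), ⟨fun e => ⟨⟨f.edge_right e, f.edge_left e⟩, ?_, ?_⟩,
      fun r => ⟨⟨fun L => ⟨fun t ht => f.ray_right r t ht.1, fun t ht => f.ray_left r t ht.1⟩,
        f.ray_final r⟩, ?_⟩⟩, fun p => ?_⟩
    · simp [f.edge_src]
    · simp [f.edge_tgt]
    · simp [f.ray_base]
    · rw [hf p]; cases p <;> rfl
  · rintro ⟨f, hf, h⟩
    exact ⟨{  atVertex := f.1
              onEdge := f.2.1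
              onRay := f.2.2
              edge_src := fun e => by simp [(hf.1 e).2.1]
              edge_tgt := fun e => by simp [(hf.1 e).2.2]
              ray_base := fun r => by simp [(hf.2 r).2]
              edge_right := fun e => (hf.1 e).1.1
              edge_left := fun e => (hf.1 e).1.2
              ray_right := fun r t ht => ((hf.2 r).1.1 (t + 1)).1 t ⟨ht, by linarith⟩
              ray_left := fun r t ht => ((hf.2 r).1.1 t).2 t ⟨ht, le_rfl⟩
              ray_final := fun r => (hf.2 r).1.2 }, fun p => by rw [h p]; cases p <;> rfl⟩

theorem sum_star_one (v : G.V) :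
    ∑ h ∈ G.star v, ((Sum.elim (Sum.elim (fun _ : G.E => 1) (fun _ : G.E => 1))
      (fun _ : G.R => 1) h : ℕ) : ℤ) = (G.star v).card := by
  rw [Finset.card_eq_sum_ones, Nat.cast_sum]
  exact Finset.sum_congr rfl fun h _ => by rcases h with (e | e) | r <;> rfl

theorem isCanonicalModTwo_canonical :
    IsCanonicalModTwo (fun _ => 1) (fun _ => 1) G.canonical where
  vertex v := by
    rw [sum_star_one, canonical_apply, val]
    exact ⟨(G.star v).card - 1, by ring⟩
  edge e t ht := by simp [canonical_apply, val]
  ray r t ht := by simp [canonical_apply, val]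
  infty r := by simp [canonical_apply, val]

/-! ### Effectivity, minima and distance functions -/

theorem nonneg_of_isRightSlope {f : ℝ → ℝ} {t : ℝ} {m : ℤ} (h : IsRightSlope f t m)
    (hmin : ∀ᶠ s in 𝓝[>] t, f t ≤ f s) : 0 ≤ m := by
  obtain ⟨s, ⟨h1, h2⟩, hs⟩ := ((hmin.and h).and self_mem_nhdsWithin).exists
  have hs' : 0 < s - t := sub_pos.2 hs
  rw [h2] at h1
  have : (0 : ℝ) ≤ m := nonneg_of_mul_nonneg_left (by linarith) hs'
  exact_mod_cast this

theorem nonpos_of_isLeftSlope {f : ℝ → ℝ} {t : ℝ} {m : ℤ} (h : IsLeftSlope f t m)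
    (hmin : ∀ᶠ s in 𝓝[<] t, f t ≤ f s) : m ≤ 0 := by
  obtain ⟨s, ⟨h1, h2⟩, hs⟩ := ((hmin.and h).and self_mem_nhdsWithin).exists
  have hs' : 0 < t - s := sub_pos.2 hs
  rw [h2] at h1
  have : (0 : ℝ) ≤ -m := nonneg_of_mul_nonneg_left (by linarith) hs'
  exact_mod_cast (by linarith : (m : ℝ) ≤ 0)

theorem slopes_of_isMin {L : ℝ} {f : ℝ → ℝ} (hf : f ∈ piecewiseLinear L) {t : ℝ}
    (hmin : ∀ s ∈ Icc 0 L, f t ≤ f s) :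
    (t ∈ Ico 0 L → 0 ≤ rightSlope f t) ∧ (t ∈ Ioc 0 L → leftSlope f t ≤ 0) := by
  constructor
  · intro ht
    refine nonneg_of_isRightSlope (isRightSlope_rightSlope hf ht) ?_
    filter_upwards [Ioo_mem_nhdsGT ht.2] with s hs
    exact hmin s ⟨ht.1.trans hs.1.le, hs.2.le⟩
  · intro ht
    refine nonpos_of_isLeftSlope (isLeftSlope_leftSlope hf ht) ?_
    filter_upwards [Ioo_mem_nhdsLT ht.1] with s hs
    exact hmin s ⟨hs.1.le, hs.2.le.trans ht.2⟩

/-- At an interior minimum the left slope is at most zero and the right slope at least zero, which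
`h` excludes. -/
theorem isMin_endpoint {L : ℝ} (hL : 0 < L) {f : ℝ → ℝ} (hf : f ∈ piecewiseLinear L)
    (h : ∀ t ∈ Ioo 0 L, leftSlope f t ≤ 0 → rightSlope f t < 0) :
    (∀ t ∈ Icc 0 L, f 0 ≤ f t) ∨ ∀ t ∈ Icc 0 L, f L ≤ f t := by
  obtain ⟨t, ht, hmin⟩ := isCompact_Icc.exists_isMinOn (nonempty_Icc.2 hL.le)
    (continuousOn_of_mem_piecewiseLinear hf)
  have hs := slopes_of_isMin hf hmin
  rcases ht.1.lt_or_eq with h0 | rfl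
  · rcases ht.2.lt_or_eq with h1 | rfl
    · exact absurd (h t ⟨h0, h1⟩ (hs.2 ⟨h0, h1.le⟩)) (not_lt.2 (hs.1 ⟨h0.le, h1⟩))
    · exact Or.inr hmin
  · exact Or.inl hmin

/-- If all slopes of the witness are odd, then the theta characteristic is not effective. -/
theorem IsThetaFunction.not_effective {θ : G.Divisor} {f : G.FunctionFamily}
    (hf : IsThetaFunction (fun _ => 1) (fun _ => 1) G.canonical θ f)
    (h0 : slopeParity (fun _ => 1) f = 0) : ¬ ∀ p, 0 ≤ θ p := by
  intro hθ
  have hE := hf.slopes_edge isCanonicalModTwo_canonical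
  have hR := hf.slopes_ray isCanonicalModTwo_canonical
  have odd0 : ∀ e, rightSlope (f.2.1 e) 0 % 2 = 1 := by
    intro e
    have h1 := congrFun h0 e
    have h2 : (((1 : ℤ) + rightSlope (f.2.1 e) 0 : ℤ) : ZMod 2) = 0 := by
      simpa [slopeParity] using h1
    have := Int.even_iff.1 (even_of_intCast_zmod_two h2)
    omega
  have oddR : ∀ e, ∀ t ∈ Ico 0 (G.len e), rightSlope (f.2.1 e) t % 2 = 1 := fun e t ht =>
    Eq.trans ((hE e).1 t ht) (odd0 e)
  have oddL : ∀ e, ∀ t ∈ Ioc 0 (G.len e), leftSlope (f.2.1 e) t % 2 = 1 := fun e t ht =>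
    Eq.trans ((hE e).2 t ht) (odd0 e)
  -- Effectivity makes the right slope at most the left one, and an odd slope is not zero.
  have concE : ∀ e, ∀ t ∈ Ioo 0 (G.len e), leftSlope (f.2.1 e) t ≤ 0 →
      rightSlope (f.2.1 e) t < 0 := by
    intro e t ht hl
    have h1 : _ = _ + (leftSlope (f.2.1 e) t - rightSlope (f.2.1 e) t) := hf.eq (.edge e t ht)
    have h2 := hθ (.edge e t ht)
    rw [canonical_apply, val] at h1
    have := oddR e t ⟨ht.1.le, ht.2⟩
    have := oddL e t ⟨ht.1, ht.2.le⟩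
    push_cast at h1
    omega
  have concR : ∀ r, ∀ t > 0, leftSlope (f.2.2 r) t ≤ 0 → rightSlope (f.2.2 r) t < 0 := by
    intro r t ht hl
    have h1 : _ = _ + (leftSlope (f.2.2 r) t - rightSlope (f.2.2 r) t) := hf.eq (.ray r t ht)
    have h2 := hθ (.ray r t ht)
    rw [canonical_apply, val] at h1
    have h3 : rightSlope (f.2.2 r) t % 2 = 1 := (hR r).1 t ht.le
    have h4 : leftSlope (f.2.2 r) t % 2 = 1 := (hR r).2.1 t ht
    push_cast at h1
    omega
  obtain ⟨v, hv⟩ : ∃ v, ∀ u, f.1 v ≤ f.1 u := by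
    have := G.nonempty
    exact Finite.exists_min f.1
  -- On an edge at `v` the minimum is attained at an end, hence at `v` by the choice of `v`. So the
  -- outgoing slope is non-negative, and being odd it is at least 1.
  have hslope : ∀ h ∈ G.star v, 1 ≤ slopeAlong f h := by
    intro h hh
    rw [mem_star] at hh
    rcases h with (e | e) | r
    · have h1 : G.src e = v := hh
      have hmin : ∀ s ∈ Icc 0 (G.len e), f.2.1 e 0 ≤ f.2.1 e s := by
        rcases isMin_endpoint (G.len_pos e) (hf.mem.1 e).1 (concE e) with h | h
        · exact h
        · intro s hs
          refine le_trans ?_ (h s hs)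
          rw [(hf.mem.1 e).2.1, (hf.mem.1 e).2.2, h1]
          simpa using hv _
      have h2 := (slopes_of_isMin (hf.mem.1 e).1 hmin).1 ⟨le_rfl, G.len_pos e⟩
      have h3 := odd0 e
      simp only [slopeAlong, Sum.elim_inl]
      omega
    · have h1 : G.tgt e = v := hh
      have hmin : ∀ s ∈ Icc 0 (G.len e), f.2.1 e (G.len e) ≤ f.2.1 e s := by
        rcases isMin_endpoint (G.len_pos e) (hf.mem.1 e).1 (concE e) with h | h
        · intro s hs
          refine le_trans ?_ (h s hs)
          rw [(hf.mem.1 e).2.1, (hf.mem.1 e).2.2, h1]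
          simpa using hv _
        · exact h
      have h2 := (slopes_of_isMin (hf.mem.1 e).1 hmin).2 ⟨G.len_pos e, le_rfl⟩
      have h3 := oddL e _ ⟨G.len_pos e, le_rfl⟩
      simp only [slopeAlong, Sum.elim_inl, Sum.elim_inr]
      omega
    · obtain ⟨T, hT, hT'⟩ := exists_forall_ge_slopes_eq_finalSlope (hf.mem.2 r).1
      -- At infinity `2θ` is the final slope minus 1. This excludes below that the minimum on `[0,
      -- T]` is at `T`.
      have hfin : 1 ≤ finalSlope (f.2.2 r) := by
        have h1 : _ = _ + finalSlope (f.2.2 r) := hf.eq (.infty r)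
        have h2 := hθ (.infty r)
        rw [canonical_apply, val] at h1
        push_cast at h1
        omega
      have hmin : ∀ s ∈ Icc 0 T, f.2.2 r 0 ≤ f.2.2 r s := by
        rcases isMin_endpoint hT ((hf.mem.2 r).1.1 T) (fun t ht => concR r t ht.1) with h | h
        · exact h
        · have h1 := (slopes_of_isMin ((hf.mem.2 r).1.1 T) h).2 ⟨hT, le_rfl⟩
          rw [(hT' T le_rfl).2] at h1
          omega
      have h2 := (slopes_of_isMin ((hf.mem.2 r).1.1 T) hmin).1 ⟨le_rfl, hT⟩
      have h3 : rightSlope (f.2.2 r) 0 % 2 = 1 := (hR r).1 0 le_rfl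
      simp only [slopeAlong, Sum.elim_inr]
      omega
  -- Slopes of at least 1 on all half-edges give `2 θ(v) ≤ val v - 2 - val v = -2`.
  have h1 : _ = _ + ∑ h ∈ G.star v, -slopeAlong f h := hf.eq (.vertex v)
  have h2 := hθ (.vertex v)
  rw [canonical_apply, val, Finset.sum_neg_distrib] at h1
  have h3 := Finset.card_nsmul_le_sum _ _ _ hslope
  rw [nsmul_eq_mul, mul_one] at h3
  linarith

/-- The existence of a distance function to a non-empty set of vertices. -/
theorem exists_distance {S : Set G.V} (hS : S.Nonempty) : ∃ d : G.V → ℝ, (∀ v ∈ S, d v = 0) ∧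
    (∀ e, |d (G.src e) - d (G.tgt e)| ≤ G.len e) ∧
    ∀ v ∉ S, ∃ e, (G.src e = v ∧ d v = d (G.tgt e) + G.len e) ∨
      (G.tgt e = v ∧ d v = d (G.src e) + G.len e) := by
  classical
  -- The distance to `S` is found as an element of `A`, the 1-Lipschitz functions vanishing on `S`,
  -- with the largest sum of values. `A` is compact because connectedness bounds the values.
  set A : Set (G.V → ℝ) := {d | (∀ v ∈ S, d v = 0) ∧
    ∀ e, |d (G.src e) - d (G.tgt e)| ≤ G.len e} with hA
  have hclosed : IsClosed A := by
    have : A = (⋂ v ∈ S, {d | d v = 0}) ∩ ⋂ e, {d | |d (G.src e) - d (G.tgt e)| ≤ G.len e} := by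
      ext d; simp [A]
    rw [this]
    refine IsClosed.inter (isClosed_biInter fun v _ => isClosed_eq (by fun_prop) (by fun_prop))
      (isClosed_iInter fun e => isClosed_le (by fun_prop) (by fun_prop))
  have hdist : ∀ u v, ∃ C, ∀ d ∈ A, |d u - d v| ≤ C := by
    intro u v
    induction G.connected u v with
    | rel a b h =>
      obtain ⟨e, rfl, rfl⟩ := h
      exact ⟨_, fun d hd => hd.2 e⟩
    | refl a => exact ⟨0, fun d _ => by simp⟩
    | symm a b _ ih =>
      obtain ⟨C, hC⟩ := ih
      exact ⟨C, fun d hd => by rw [abs_sub_comm]; exact hC d hd⟩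
    | trans a b c _ _ ih ih' =>
      obtain ⟨C, hC⟩ := ih
      obtain ⟨C', hC'⟩ := ih'
      exact ⟨C + C', fun d hd => (abs_sub_le _ (d b) _).trans (add_le_add (hC d hd) (hC' d hd))⟩
  obtain ⟨v₀, hv₀⟩ := hS
  choose C hC using hdist v₀
  have hcompact : IsCompact A := by
    refine (isCompact_univ_pi fun v => isCompact_Icc (a := -C v) (b := C v)).of_isClosed_subset
      hclosed fun d hd v _ => ?_
    have := hC v d hd
    rw [hd.1 v₀ hv₀, zero_sub, abs_neg] at this
    exact abs_le.1 this
  obtain ⟨d, hd, hmax⟩ := hcompact.exists_isMaxOn (f := fun d => ∑ v, d v)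
    ⟨0, fun v _ => rfl, fun e => by simpa using (G.len_pos e).le⟩ (by fun_prop)
  refine ⟨d, hd.1, hd.2, fun v hv => ?_⟩
  -- If no edge at `v` were tight with the smaller value at its other end, `d v` could be increased
  -- slightly within `A`, against maximality.
  by_contra! hcon
  have hev : ∀ᶠ δ in 𝓝[>] (0 : ℝ), ∀ e,
      (G.src e = v → d v < d (G.tgt e) + G.len e → d v + δ ≤ d (G.tgt e) + G.len e) ∧
      (G.tgt e = v → d v < d (G.src e) + G.len e → d v + δ ≤ d (G.src e) + G.len e) := by
    rw [eventually_all]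
    intro e
    refine Eventually.and ?_ ?_
    · by_cases h : d v < d (G.tgt e) + G.len e
      · filter_upwards [Ioo_mem_nhdsGT (sub_pos.2 h)] with δ hδ _ _
        linarith [hδ.2]
      · exact Eventually.of_forall fun δ _ h' => absurd h' h
    · by_cases h : d v < d (G.src e) + G.len e
      · filter_upwards [Ioo_mem_nhdsGT (sub_pos.2 h)] with δ hδ _ _
        linarith [hδ.2]
      · exact Eventually.of_forall fun δ _ h' => absurd h' h
  obtain ⟨δ, hδ, hδ0⟩ := (hev.and self_mem_nhdsWithin).exists
  have hδ0 : 0 < δ := hδ0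
  have hmem : Function.update d v (d v + δ) ∈ A := by
    refine ⟨fun u hu => ?_, fun e => ?_⟩
    · rw [Function.update_of_ne (by rintro rfl; exact hv hu)]; exact hd.1 u hu
    · have h1 := abs_le.1 (hd.2 e)
      have h2 := hcon e
      by_cases hs : G.src e = v <;> by_cases ht : G.tgt e = v
      -- At a loop both end values change together.
      · rw [hs, ht]; simpa using (G.len_pos e).le
      · rw [hs, Function.update_self, Function.update_of_ne ht]
        rw [hs] at h1
        have := (hδ e).1 hs (lt_of_le_of_ne (by linarith [h1.2]) (h2.1 hs))
        rw [abs_le]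
        constructor <;> linarith [h1.1]
      · rw [ht, Function.update_self, Function.update_of_ne hs]
        rw [ht] at h1
        have := (hδ e).2 ht (lt_of_le_of_ne (by linarith [h1.1]) (h2.2 ht))
        rw [abs_le]
        constructor <;> linarith [h1.2]
      · rw [Function.update_of_ne hs, Function.update_of_ne ht]; exact hd.2 e
  have hle := isMaxOn_iff.1 hmax _ hmem
  rw [Finset.sum_update_of_mem (Finset.mem_univ v)] at hle
  have := Finset.add_sum_erase Finset.univ d (Finset.mem_univ v)
  rw [← Finset.sdiff_singleton_eq_erase] at this
  linarith

/-- Every cycle modulo two comes from a theta characteristic, which is effective if the cycle is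
non-zero. -/
theorem exists_isThetaFunction {γ : G.E → ZMod 2} (hγ : γ ∈ LinearMap.ker G.boundary) :
    ∃ (θ : G.Divisor) (f : G.FunctionFamily),
      IsThetaFunction (fun _ => 1) (fun _ => 1) G.canonical θ f ∧
      slopeParity (fun _ => 1) f = γ ∧ (γ ≠ 0 → ∀ p, 0 ≤ θ p) := by
  classical
  -- `S` is the set of vertices on the support of `γ`. For `γ = 0` any single vertex serves, as
  -- effectivity is then not claimed.
  obtain ⟨S, hSne, hSγ, hγS⟩ : ∃ S : Set G.V, S.Nonempty ∧
      (∀ e, γ e ≠ 0 → G.src e ∈ S ∧ G.tgt e ∈ S) ∧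
      (γ ≠ 0 → ∀ v ∈ S, ∃ e, γ e ≠ 0 ∧ (G.src e = v ∨ G.tgt e = v)) := by
    by_cases h : γ = 0
    · obtain ⟨v₀⟩ := G.nonempty
      exact ⟨{v₀}, ⟨v₀, rfl⟩, fun e he => absurd (congrFun h e) he, fun h' => absurd h h'⟩
    · obtain ⟨e, he⟩ := Function.ne_iff.1 h
      exact ⟨{v | ∃ e, γ e ≠ 0 ∧ (G.src e = v ∨ G.tgt e = v)}, ⟨_, e, he, Or.inl rfl⟩,
        fun e he => ⟨⟨e, he, Or.inl rfl⟩, ⟨e, he, Or.inr rfl⟩⟩, fun _ v hv => hv⟩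
  obtain ⟨d, hd0, hdL, hdS⟩ := exists_distance hSne
  -- Slope 0 exactly on the edges with `γ e = 1`, and slopes `±1` elsewhere, so that 1 plus the
  -- slope has parity `γ`. The tents meet the values of `d` because `d` is 1-Lipschitz along edges.
  set f : G.FunctionFamily := (d,
    fun e => if γ e = 0 then tent (G.len e) (d (G.src e)) (d (G.tgt e)) 1 else 0,
    fun r s => d (G.base r) + (1 : ℤ) * s) with hf
  have hR : ∀ e t, rightSlope (f.2.1 e) t = if γ e = 0 then
      (if d (G.src e) + t < d (G.tgt e) + (G.len e - t) then 1 else -1) else 0 := by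
    intro e t
    by_cases h : γ e = 0
    · simp only [f, h, if_true]
      simpa using (isRightSlope_tent (G.len e) (d (G.src e)) (d (G.tgt e)) zero_le_one t).eq
    · simp only [f, h, if_false]
      exact IsRightSlope.eq (Eventually.of_forall fun s => by simp)
  have hL : ∀ e t, leftSlope (f.2.1 e) t = if γ e = 0 then
      (if d (G.src e) + t ≤ d (G.tgt e) + (G.len e - t) then 1 else -1) else 0 := by
    intro e t
    by_cases h : γ e = 0
    · simp only [f, h, if_true]
      simpa using (isLeftSlope_tent (G.len e) (d (G.src e)) (d (G.tgt e)) zero_le_one t).eq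
    · simp only [f, h, if_false]
      exact IsLeftSlope.eq (Eventually.of_forall fun s => by simp)
  have hRr : ∀ r t, rightSlope (f.2.2 r) t = 1 := fun r t => (IsRightSlope.affine _ 1 t).eq
  have hLr : ∀ r t, leftSlope (f.2.2 r) t = 1 := fun r t => (IsLeftSlope.affine _ 1 t).eq
  have hFr : ∀ r, finalSlope (f.2.2 r) = 1 := fun r => (IsFinalSlope.affine _ 1).eq
  have hmem : f ∈ G.weightedFunctions (fun _ => 1) (fun _ => 1) := by
    refine ⟨fun e => ?_, fun r => ⟨affine_mem_piecewiseLinearRay _ 1, by simp [f]⟩⟩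
    have h1 := abs_le.1 (hdL e)
    by_cases h : γ e = 0
    · simp only [f, h, if_true]
      refine ⟨tent_mem_piecewiseLinear _ _ _ zero_le_one, ?_, ?_⟩
      · simp only [tent, Int.cast_one, one_mul, add_zero, sub_zero, Nat.cast_one]
        exact min_eq_left (by linarith)
      · simp only [tent, Int.cast_one, one_mul, add_zero, sub_self, Nat.cast_one]
        exact min_eq_right (by linarith)
    · simp only [f, h, if_false]
      refine ⟨zero_mem _, ?_, ?_⟩
      · simp [hd0 _ (hSγ e h).1]
      · simp [hd0 _ (hSγ e h).2]
  have hγ1 : ∀ e, γ e ≠ 0 → γ e = 1 := fun e he => Fin.eq_one_of_ne_zero (γ e) he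
  have hsl : ∀ h, slopeAlong f h ≤ 1 := by
    rintro ((e | e) | r)
    · simp only [slopeAlong, Sum.elim_inl, hR]; split_ifs <;> norm_num
    · simp only [slopeAlong, Sum.elim_inl, Sum.elim_inr, hL]; split_ifs <;> norm_num
    · simp only [slopeAlong, Sum.elim_inr, hRr]; norm_num
  have hvert : ∀ v, G.canonical (.vertex v) + orderAt f (.vertex v) =
      ∑ h ∈ G.star v, (1 - slopeAlong f h) - 2 := by
    intro v
    rw [canonical_apply, val, Finset.sum_sub_distrib, orderAt, Finset.sum_neg_distrib]
    simp; ring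
  have heven : ∀ p, Even (G.canonical p + orderAt f p) := by
    intro p
    cases p with
    | vertex v =>
      rw [hvert]
      refine Even.sub (even_of_intCast_zmod_two ?_) even_two
      push_cast
      rw [sum_star]
      have h1 := congrFun (LinearMap.mem_ker.1 hγ) v
      rw [boundary_apply] at h1
      refine Eq.trans ?_ h1
      rw [Finset.sum_eq_zero (s := Finset.univ (α := G.R)), add_zero]
      · refine Finset.sum_congr rfl fun e _ => ?_
        congr 1 <;> congr 1
        · simp only [slopeAlong, Sum.elim_inl, hR]
          by_cases h : γ e = 0
          · rw [if_pos h, h]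
            split_ifs <;> simp
          · rw [if_neg h, hγ1 e h]; simp
        · simp only [slopeAlong, Sum.elim_inl, Sum.elim_inr, hL]
          by_cases h : γ e = 0
          · rw [if_pos h, h]
            split_ifs <;> simp
          · rw [if_neg h, hγ1 e h]; simp
      · intro r _
        simp [slopeAlong, hRr]
    | edge e t ht =>
      simp only [canonical_apply, val, orderAt, hR, hL]
      split_ifs <;> decide
    | ray r t ht => simp [canonical_apply, val, orderAt, hRr, hLr]
    | infty r => simp [canonical_apply, val, orderAt, hFr]
  obtain ⟨D, hD⟩ := exists_divisor_eq_orderAt hmem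
  -- `θ` is half of `K + div f`; the division is exact by `heven`.
  have hθ : ∀ p, 2 * ((G.canonical + D).mapRange (· / 2) (by norm_num)) p =
      G.canonical p + orderAt f p := by
    intro p
    rw [Finsupp.mapRange_apply, Finsupp.add_apply, hD]
    exact Int.two_mul_ediv_two_of_even (heven p)
  refine ⟨_, f, ⟨hmem, hθ⟩, ?_, fun hne p => ?_⟩
  · ext e
    simp only [slopeParity, hR]
    have e3 : (1 : ZMod 2) + 1 = 0 := rfl
    by_cases h : γ e = 0
    · rw [if_pos h, h]
      split_ifs <;> simp [e3]
    · rw [if_neg h, hγ1 e h]; simp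
  · have h1 := hθ p
    -- An even number that is at least `-1` is non-negative.
    suffices -1 ≤ G.canonical p + orderAt f p by omega
    cases p with
    | vertex v =>
      rw [hvert]
      -- All terms `1 - slope` are non-negative, so one term of at least 1 suffices. A half-edge in
      -- the support of `γ` has slope 0; at a vertex outside `S` a tight edge descends with slope
      -- `-1`.
      suffices ∃ h ∈ G.star v, slopeAlong f h ≤ 0 by
        obtain ⟨h, hh, hle⟩ := this
        have h2 := Finset.single_le_sum (f := fun h => 1 - slopeAlong f h)
          (fun x _ => sub_nonneg.2 (hsl x)) hh
        linarith
      by_cases hv : v ∈ S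
      · obtain ⟨e, he, h | h⟩ := hγS hne v hv
        · exact ⟨.inl (.inl e), mem_star.2 h, by simp [slopeAlong, hR, he]⟩
        · exact ⟨.inl (.inr e), mem_star.2 h, by simp [slopeAlong, hL, he]⟩
      · obtain ⟨e, ⟨h, h'⟩ | ⟨h, h'⟩⟩ := hdS v hv
        · refine ⟨.inl (.inl e), mem_star.2 h, ?_⟩
          simp only [slopeAlong, Sum.elim_inl, hR, h, h']
          split_ifs <;> linarith
        · refine ⟨.inl (.inr e), mem_star.2 h, ?_⟩
          simp only [slopeAlong, Sum.elim_inl, Sum.elim_inr, hL, h, h']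
          split_ifs <;> linarith
    | edge e t ht =>
      simp only [canonical_apply, val, orderAt, hR, hL]
      split_ifs with h2 h3 h4 <;> first | linarith | norm_num
    | ray r t ht => simp [canonical_apply, val, orderAt, hRr, hLr]
    | infty r => simp [canonical_apply, val, orderAt, hFr]

end MetricGraph

/-- `j` need only reach the points of the fibre where `D` is non-zero. This matters for vertices,
whose fibres contain whole loops. -/
theorem Finsupp.mapDomain_apply_eq_sum_of_injective {α β ι : Type*} [Fintype ι] (φ : α → β)
    (D : α →₀ ℤ) (b : β) (j : ι → α) (hj : Function.Injective j) (hφ : ∀ i, φ (j i) = b)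
    (h : ∀ a, φ a = b → D a ≠ 0 → ∃ i, j i = a) : Finsupp.mapDomain φ D b = ∑ i, D (j i) := by
  classical
  rw [Finsupp.mapDomain, Finsupp.sum_apply, Finsupp.sum]
  simp only [Finsupp.single_apply]
  rw [← Finset.sum_image (f := D) (s := Finset.univ) hj.injOn, ← Finset.sum_filter]
  refine Finset.sum_subset (fun a ha => ?_) (fun a ha ha' => ?_)
  · rw [Finset.mem_filter, Finsupp.mem_support_iff] at ha
    obtain ⟨i, rfl⟩ := h a ha.2 ha.1
    exact Finset.mem_image_of_mem _ (Finset.mem_univ i)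
  · obtain ⟨i, -, rfl⟩ := Finset.mem_image.1 ha
    by_contra hne
    exact ha' (Finset.mem_filter.2 ⟨Finsupp.mem_support_iff.2 hne, hφ i⟩)

namespace TropicalPlaneCurve

open MetricGraph

variable {Γ : TropicalPlaneCurve} {ε : ℝ} (hε : 0 < ε)

/-! ### The edges of the paired graph -/

/-- A vertex of the curve as a vertex of the paired graph. -/
def pairedVertex (v : Γ.graph.V) : (Γ.paired ε hε).V := v

/-- The edges of the paired graph over a bounded edge. -/
def pairedEdge (e : Γ.graph.E) (i : Fin (Γ.weightE e)) : (Γ.paired ε hε).E := .inl ⟨e, i⟩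

/-- The loops of the paired graph at a vertex. -/
def pairedLoop (v : Γ.graph.V) (y : Fin (Γ.vertexWeight v)) : (Γ.paired ε hε).E := .inr ⟨v, y⟩

/-- The rays of the paired graph over a ray. -/
def pairedRay (r : Γ.graph.R) (i : Fin (Γ.weightR r)) : (Γ.paired ε hε).R := ⟨r, i⟩

/-- A function on the edges of the paired graph, given on edges and on loops. -/
def edgeElim {M : Type*} (A : ∀ e, Fin (Γ.weightE e) → M) (B : ∀ v, Fin (Γ.vertexWeight v) → M) :
    (Γ.paired ε hε).E → M := Sum.elim (fun x => A x.1 x.2) fun y => B y.1 y.2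

/-- A function on the rays of the paired graph. -/
def rayElim {M : Type*} (A : ∀ r, Fin (Γ.weightR r) → M) : (Γ.paired ε hε).R → M :=
  fun x => A x.1 x.2

section

variable {M : Type*} (A : ∀ e, Fin (Γ.weightE e) → M) (B : ∀ v, Fin (Γ.vertexWeight v) → M)
  (C : ∀ r, Fin (Γ.weightR r) → M)

@[simp] theorem edgeElim_pairedEdge (e i) : edgeElim hε A B (pairedEdge hε e i) = A e i := rfl

@[simp] theorem edgeElim_pairedLoop (v y) : edgeElim hε A B (pairedLoop hε v y) = B v y := rfl

@[simp] theorem rayElim_pairedRay (r i) : rayElim hε C (pairedRay hε r i) = C r i := rfl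

end

theorem pairedEdge_or_pairedLoop (x : (Γ.paired ε hε).E) :
    (∃ e i, x = pairedEdge hε e i) ∨ ∃ v y, x = pairedLoop hε v y := by
  rcases x with x | y
  · exact Or.inl ⟨x.1, x.2, rfl⟩
  · exact Or.inr ⟨y.1, y.2, rfl⟩

theorem pairedRay_surjective (x : (Γ.paired ε hε).R) : ∃ r i, x = pairedRay hε r i :=
  ⟨x.1, x.2, rfl⟩

@[simp] theorem pairedVertex_inj {u v : Γ.graph.V} :
    pairedVertex hε u = pairedVertex hε v ↔ u = v := Iff.rfl

theorem pairedEdge_injective (e : Γ.graph.E) : Function.Injective (pairedEdge hε e) := by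
  intro i j h
  have h : (Sum.inl ⟨e, i⟩ : (Σ e, Fin (Γ.weightE e)) ⊕ (Σ v, Fin (Γ.vertexWeight v))) =
    .inl ⟨e, j⟩ := h
  simpa using h

theorem pairedLoop_injective (v : Γ.graph.V) : Function.Injective (pairedLoop hε v) := by
  intro i j h
  have h : (Sum.inr ⟨v, i⟩ : (Σ e, Fin (Γ.weightE e)) ⊕ (Σ v, Fin (Γ.vertexWeight v))) =
    .inr ⟨v, j⟩ := h
  simpa using h

theorem pairedRay_injective (r : Γ.graph.R) : Function.Injective (pairedRay hε r) := by
  intro i j h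
  have h : (⟨r, i⟩ : Σ r, Fin (Γ.weightR r)) = ⟨r, j⟩ := h
  simpa using h

@[simp] theorem src_pairedEdge (e i) : (Γ.paired ε hε).src (pairedEdge hε e i) =
    pairedVertex hε (Γ.graph.src e) := rfl

@[simp] theorem tgt_pairedEdge (e i) : (Γ.paired ε hε).tgt (pairedEdge hε e i) =
    pairedVertex hε (Γ.graph.tgt e) := rfl

@[simp] theorem src_pairedLoop (v y) : (Γ.paired ε hε).src (pairedLoop hε v y) =
    pairedVertex hε v := rfl

@[simp] theorem tgt_pairedLoop (v y) : (Γ.paired ε hε).tgt (pairedLoop hε v y) =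
    pairedVertex hε v := rfl

@[simp] theorem base_pairedRay (r i) : (Γ.paired ε hε).base (pairedRay hε r i) =
    pairedVertex hε (Γ.graph.base r) := rfl

@[simp] theorem len_pairedEdge (e i) : (Γ.paired ε hε).len (pairedEdge hε e i) =
    Γ.graph.len e := rfl

@[simp] theorem len_pairedLoop (v y) : (Γ.paired ε hε).len (pairedLoop hε v y) = ε := rfl

theorem pairing_vertex (v : Γ.graph.V) :
    Γ.pairing ε hε (.vertex (pairedVertex hε v)) = .vertex v := rfl

theorem pairing_edge (e i t ht) :
    Γ.pairing ε hε (.edge (pairedEdge hε e i) t ht) = .edge e t ht := rfl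

theorem pairing_loop (v y t ht) :
    Γ.pairing ε hε (.edge (pairedLoop hε v y) t ht) = .vertex v := rfl

theorem pairing_ray (r i t ht) :
    Γ.pairing ε hε (.ray (pairedRay hε r i) t ht) = .ray r t ht := rfl

theorem pairing_infty (r i) : Γ.pairing ε hε (.infty (pairedRay hε r i)) = .infty r := rfl

theorem pairedPoint_induction {C : (Γ.paired ε hε).Point → Prop}
    (vertex : ∀ v, C (.vertex (pairedVertex hε v)))
    (edge : ∀ e i t ht, C (.edge (pairedEdge hε e i) t ht))
    (loop : ∀ v y t ht, C (.edge (pairedLoop hε v y) t ht))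
    (ray : ∀ r i t ht, C (.ray (pairedRay hε r i) t ht))
    (infty : ∀ r i, C (.infty (pairedRay hε r i))) (p : (Γ.paired ε hε).Point) : C p := by
  rcases p with v | ⟨x | y, t, ht⟩ | ⟨x, t, ht⟩ | x
  · exact vertex v
  · exact edge x.1 x.2 t ht
  · exact loop y.1 y.2 t ht
  · exact ray x.1 x.2 t ht
  · exact infty x.1 x.2

theorem sum_paired_edges {M : Type*} [AddCommMonoid M] (A : (Γ.paired ε hε).E → M) :
    ∑ e, A e = ∑ e, ∑ i, A (pairedEdge hε e i) + ∑ v, ∑ y, A (pairedLoop hε v y) := by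
  have h := Fintype.sum_sum_type (α₁ := Σ e, Fin (Γ.weightE e))
    (α₂ := Σ v, Fin (Γ.vertexWeight v)) A
  rw [Fintype.sum_sigma, Fintype.sum_sigma] at h
  exact h

theorem sum_paired_rays {M : Type*} [AddCommMonoid M] (A : (Γ.paired ε hε).R → M) :
    ∑ r, A r = ∑ r, ∑ i, A (pairedRay hε r i) :=
  Fintype.sum_sigma (ι := Γ.graph.R) (α := fun r => Fin (Γ.weightR r)) A

/-- The sum over the half-edges of the paired graph that lie over a half-edge. -/
def sumOver {M : Type*} [AddCommMonoid M] (F : (Γ.paired ε hε).HalfEdge → M) :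
    Γ.graph.HalfEdge → M :=
  Sum.elim (Sum.elim (fun e => ∑ i, F (.inl (.inl (pairedEdge hε e i))))
    (fun e => ∑ i, F (.inl (.inr (pairedEdge hε e i))))) (fun r => ∑ i, F (.inr (pairedRay hε r i)))

/-- Every loop at `v` contributes both of its half-edges. -/
theorem sum_star_paired {M : Type*} [AddCommMonoid M] (F : (Γ.paired ε hε).HalfEdge → M)
    (v : Γ.graph.V) : ∑ h ∈ (Γ.paired ε hε).star (pairedVertex hε v), F h =
    ∑ h ∈ Γ.graph.star v, sumOver hε F h + ∑ y : Fin (Γ.vertexWeight v),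
      (F (.inl (.inl (pairedLoop hε v y))) + F (.inl (.inr (pairedLoop hε v y)))) := by
  classical
  rw [sum_star, sum_star, sum_paired_edges, sum_paired_rays, add_right_comm]
  simp only [sumOver, Sum.elim_inl, Sum.elim_inr, src_pairedEdge, tgt_pairedEdge, base_pairedRay,
    src_pairedLoop, tgt_pairedLoop, pairedVertex_inj, Finset.sum_add_distrib,
    Finset.sum_ite_irrel, Finset.sum_const_zero, Finset.sum_ite_eq', Finset.mem_univ, if_true]

/-! ### The pushforward of divisors -/

theorem pushDiv_edge (D : (Γ.paired ε hε).Divisor) (e : Γ.graph.E) (t : ℝ)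
    (ht : t ∈ Ioo 0 (Γ.graph.len e)) :
    Γ.pushDiv ε hε D (.edge e t ht) = ∑ i, D (.edge (pairedEdge hε e i) t ht) := by
  refine Finsupp.mapDomain_apply_eq_sum_of_injective _ D _
    (fun i => Point.edge (pairedEdge hε e i) t ht) ?_ (fun _ => rfl) ?_
  · intro i j hij
    exact pairedEdge_injective hε e (Point.edge.inj hij).1
  · refine pairedPoint_induction hε ?_ ?_ ?_ ?_ ?_
    all_goals simp only [pairing_vertex, pairing_edge, pairing_loop, pairing_ray, pairing_infty, reduceCtorEq,
      IsEmpty.forall_iff, implies_true]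
    rintro _ i _ _ ⟨⟩ -
    exact ⟨i, rfl⟩

theorem pushDiv_ray (D : (Γ.paired ε hε).Divisor) (r : Γ.graph.R) (t : ℝ) (ht : 0 < t) :
    Γ.pushDiv ε hε D (.ray r t ht) = ∑ i, D (.ray (pairedRay hε r i) t ht) := by
  refine Finsupp.mapDomain_apply_eq_sum_of_injective _ D _
    (fun i => Point.ray (pairedRay hε r i) t ht) ?_ (fun _ => rfl) ?_
  · intro i j hij
    exact pairedRay_injective hε r (Point.ray.inj hij).1
  · refine pairedPoint_induction hε ?_ ?_ ?_ ?_ ?_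
    all_goals simp only [pairing_vertex, pairing_edge, pairing_loop, pairing_ray, pairing_infty, reduceCtorEq,
      IsEmpty.forall_iff, implies_true]
    rintro _ i _ _ ⟨⟩ -
    exact ⟨i, rfl⟩

theorem pushDiv_infty (D : (Γ.paired ε hε).Divisor) (r : Γ.graph.R) :
    Γ.pushDiv ε hε D (.infty r) = ∑ i, D (.infty (pairedRay hε r i)) := by
  refine Finsupp.mapDomain_apply_eq_sum_of_injective _ D _
    (fun i => Point.infty (pairedRay hε r i)) ?_ (fun _ => rfl) ?_
  · intro i j hij
    exact pairedRay_injective hε r (Point.infty.inj hij)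
  · refine pairedPoint_induction hε ?_ ?_ ?_ ?_ ?_
    all_goals simp only [pairing_vertex, pairing_edge, pairing_loop, pairing_ray, pairing_infty, reduceCtorEq,
      IsEmpty.forall_iff, implies_true, Point.infty.injEq]
    rintro _ i rfl -
    exact ⟨i, rfl⟩

/-- The fibre over `v` is the vertex with the interiors of its loops. Only the bends on a loop
contribute, and they add up to its total change of slope. -/
theorem pushDiv_vertex {D : (Γ.paired ε hε).Divisor} {f : (Γ.paired ε hε).FunctionFamily}
    (hf : f ∈ (Γ.paired ε hε).weightedFunctions (fun _ => 1) (fun _ => 1))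
    (hD : ∀ p, D p = orderAt f p) (v : Γ.graph.V) :
    Γ.pushDiv ε hε D (.vertex v) = orderAt f (.vertex (pairedVertex hε v)) +
      ∑ y, (rightSlope (f.2.1 (pairedLoop hε v y)) 0 - leftSlope (f.2.1 (pairedLoop hε v y)) ε) := by
  classical
  have hL : ∀ y, f.2.1 (pairedLoop hε v y) ∈ piecewiseLinear ε := fun y =>
    (hf.1 (pairedLoop hε v y)).1
  have hfin := fun y => finite_breakpoints (hL y)
  have hmem : ∀ y, ∀ t ∈ (hfin y).toFinset, t ∈ Ioo 0 ε := fun y t ht =>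
    ((hfin y).mem_toFinset.1 ht).1
  -- `none` stands for the vertex itself, `some` for a bend on one of the loops.
  have := Finsupp.mapDomain_apply_eq_sum_of_injective (ι := Option (Σ y, (hfin y).toFinset))
    (Γ.pairing ε hε) D (.vertex v) (fun o => o.elim (.vertex (pairedVertex hε v))
      fun x => .edge (pairedLoop hε v x.1) x.2.1 (hmem x.1 x.2.1 x.2.2)) ?_ ?_ ?_
  · refine Eq.trans this ?_
    rw [Fintype.sum_option, Fintype.sum_sigma]
    simp only [Option.elim, hD]
    congr 1
    refine Finset.sum_congr rfl fun y _ => ?_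
    rw [← sum_leftSlope_sub_rightSlope hε (hL y) (hfin y).toFinset (hmem y)
      fun t ht h => (hfin y).mem_toFinset.2 ⟨ht, h⟩]
    exact Finset.sum_coe_sort (hfin y).toFinset fun t =>
      leftSlope (f.2.1 (pairedLoop hε v y)) t - rightSlope (f.2.1 (pairedLoop hε v y)) t
  · rintro (_ | ⟨y, t, ht⟩) (_ | ⟨y', t', ht'⟩) h
    · rfl
    · simp at h
    · simp at h
    · obtain ⟨h1, h2⟩ := Point.edge.inj h
      obtain rfl := pairedLoop_injective hε v h1
      obtain rfl : t = t' := h2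
      rfl
  · rintro (_ | x) <;> rfl
  · refine pairedPoint_induction hε ?_ ?_ ?_ ?_ ?_
    all_goals simp only [pairing_vertex, pairing_edge, pairing_loop, pairing_ray, pairing_infty, reduceCtorEq,
      IsEmpty.forall_iff, implies_true, Point.vertex.injEq]
    · rintro _ rfl -
      exact ⟨none, rfl⟩
    · rintro _ y t ht rfl hne
      refine ⟨some ⟨y, t, (hfin y).mem_toFinset.2 ⟨ht, ?_⟩⟩, rfl⟩
      rw [hD] at hne
      exact sub_ne_zero.1 hne

/-- The sum of a family of functions over parallel edges. -/
def pushFamily (f : (Γ.paired ε hε).FunctionFamily) : Γ.graph.FunctionFamily :=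
  (fun v => f.1 (pairedVertex hε v), fun e => ∑ i, f.2.1 (pairedEdge hε e i),
    fun r => ∑ i, f.2.2 (pairedRay hε r i))

variable {hε} {f : (Γ.paired ε hε).FunctionFamily}

/-- The weight appears in the end values because the parallel edges share their end vertices. -/
theorem pushFamily_mem (hf : f ∈ (Γ.paired ε hε).weightedFunctions (fun _ => 1) (fun _ => 1)) :
    pushFamily hε f ∈ Γ.graph.weightedFunctions Γ.weightE Γ.weightR := by
  have h0 : ∀ e i, f.2.1 (pairedEdge hε e i) 0 = f.1 (pairedVertex hε (Γ.graph.src e)) :=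
    fun e i => by simpa using (hf.1 (pairedEdge hε e i)).2.1
  have h1 : ∀ e i, f.2.1 (pairedEdge hε e i) (Γ.graph.len e) =
      f.1 (pairedVertex hε (Γ.graph.tgt e)) :=
    fun e i => by simpa using (hf.1 (pairedEdge hε e i)).2.2
  have h2 : ∀ r i, f.2.2 (pairedRay hε r i) 0 = f.1 (pairedVertex hε (Γ.graph.base r)) :=
    fun r i => by simpa using (hf.2 (pairedRay hε r i)).2
  refine ⟨fun e => ⟨?_, ?_, ?_⟩, fun r => ⟨?_, ?_⟩⟩
  · exact AddSubgroup.sum_mem (piecewiseLinear (Γ.graph.len e)) (t := Finset.univ)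
      (f := fun i => f.2.1 (pairedEdge hε e i)) fun i _ => (hf.1 (pairedEdge hε e i)).1
  · simp [pushFamily, h0]
  · simp [pushFamily, h1]
  · exact AddSubgroup.sum_mem piecewiseLinearRay (t := Finset.univ)
      (f := fun i => f.2.2 (pairedRay hε r i)) fun i _ => (hf.2 (pairedRay hε r i)).1
  · simp [pushFamily, h2]

theorem slopeAlong_pushFamily
    (hf : f ∈ (Γ.paired ε hε).weightedFunctions (fun _ => 1) (fun _ => 1)) (h : Γ.graph.HalfEdge) :
    slopeAlong (pushFamily hε f) h = sumOver hε (slopeAlong f) h := by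
  rcases h with (e | e) | r
  · exact rightSlope_sum Finset.univ (fun i _ => (hf.1 (pairedEdge hε e i)).1)
      ⟨le_rfl, Γ.graph.len_pos e⟩
  · have := leftSlope_sum Finset.univ (fun i _ => (hf.1 (pairedEdge hε e i)).1)
      (t := Γ.graph.len e) ⟨Γ.graph.len_pos e, le_rfl⟩
    simp only [slopeAlong, sumOver, Sum.elim_inl, Sum.elim_inr, pushFamily, len_pairedEdge,
      Finset.sum_neg_distrib]
    rw [this]
  · exact rightSlope_sum Finset.univ (fun i _ => (hf.2 (pairedRay hε r i)).1.1 1)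
      ⟨le_rfl, one_pos⟩

/-- The pushforward of the divisor of a rational function is the divisor of the weighted function
obtained by adding up the values on parallel edges. -/
theorem pushDiv_eq_orderAt {D : (Γ.paired ε hε).Divisor}
    (hf : f ∈ (Γ.paired ε hε).weightedFunctions (fun _ => 1) (fun _ => 1))
    (hD : ∀ p, D p = orderAt f p) (p : Γ.graph.Point) :
    Γ.pushDiv ε hε D p = orderAt (pushFamily hε f) p := by
  cases p with
  | vertex v =>
    -- The bends on the loops cancel the slopes of the loops at `v`.
    rw [pushDiv_vertex hε hf hD, orderAt, orderAt, Finset.sum_neg_distrib, Finset.sum_neg_distrib,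
      sum_star_paired, Finset.sum_congr rfl fun h _ => slopeAlong_pushFamily hf h]
    have : ∀ y : Fin (Γ.vertexWeight v), slopeAlong f (.inl (.inl (pairedLoop hε v y))) +
        slopeAlong f (.inl (.inr (pairedLoop hε v y))) =
        rightSlope (f.2.1 (pairedLoop hε v y)) 0 - leftSlope (f.2.1 (pairedLoop hε v y)) ε :=
      fun y => by
        simp only [slopeAlong, Sum.elim_inl, Sum.elim_inr, len_pairedLoop]
        ring
    rw [Finset.sum_congr rfl fun y _ => this y]
    ring
  | edge e t ht =>
    rw [pushDiv_edge]
    simp only [hD, orderAt, pushFamily]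
    rw [rightSlope_sum _ (fun i _ => (hf.1 (pairedEdge hε e i)).1) ⟨ht.1.le, ht.2⟩,
      leftSlope_sum _ (fun i _ => (hf.1 (pairedEdge hε e i)).1) ⟨ht.1, ht.2.le⟩,
      Finset.sum_sub_distrib]
  | ray r t ht =>
    rw [pushDiv_ray]
    simp only [hD, orderAt, pushFamily]
    rw [rightSlope_sum _ (fun i _ => (hf.2 (pairedRay hε r i)).1.1 (t + 1)) ⟨ht.le, by linarith⟩,
      leftSlope_sum _ (fun i _ => (hf.2 (pairedRay hε r i)).1.1 t) ⟨ht, le_rfl⟩,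
      Finset.sum_sub_distrib]
  | infty r =>
    rw [pushDiv_infty]
    simp only [hD, orderAt, pushFamily]
    rw [finalSlope_sum _ fun i _ => (hf.2 (pairedRay hε r i)).1]

/-- Put an interpolation `H e` of the vertex values on all edges over `e`, and add the error `g_e -
w_e H e`, which vanishes at both ends, to the first of them. Rays are treated likewise, with
constants as interpolations, and loops get constants. -/
theorem exists_pushFamily_eq {g : Γ.graph.FunctionFamily}
    (hg : g ∈ Γ.graph.weightedFunctions Γ.weightE Γ.weightR) :
    ∃ f ∈ (Γ.paired ε hε).weightedFunctions (fun _ => 1) (fun _ => 1), pushFamily hε f = g := by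
  choose H hH hH0 hHL using fun e => exists_piecewiseLinear_interpolation (Γ.graph.len_pos e)
    (g.1 (Γ.graph.src e)) (g.1 (Γ.graph.tgt e))
  set c : ℝ → ℝ → ℝ := fun a s => a + (0 : ℤ) * s with hc
  have hc0 : ∀ a s, c a s = a := fun a s => by simp [c]
  have hcm : ∀ a, c a ∈ piecewiseLinearRay := fun a => affine_mem_piecewiseLinearRay a 0
  have hg1 : ∀ v, (show (Γ.paired ε hε).V → ℝ from g.1) (pairedVertex hε v) = g.1 v :=
    fun _ => rfl
  refine ⟨(g.1, edgeElim hε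
    (fun e i => H e + if i = ⟨0, Γ.weightE_pos e⟩ then g.2.1 e - Γ.weightE e • H e else 0)
    (fun v _ => c (g.1 v)),
    rayElim hε fun r i => c (g.1 (Γ.graph.base r)) + if i = ⟨0, Γ.weightR_pos r⟩ then
      g.2.2 r - Γ.weightR r • c (g.1 (Γ.graph.base r)) else 0), ⟨fun x => ?_, fun x => ?_⟩, ?_⟩
  · obtain ⟨e, i, rfl⟩ | ⟨v, y, rfl⟩ := pairedEdge_or_pairedLoop hε x
    · simp only [edgeElim_pairedEdge, len_pairedEdge, src_pairedEdge, tgt_pairedEdge, hg1,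
        Nat.cast_one, one_mul, Pi.add_apply, hH0, hHL]
      refine ⟨add_mem (hH e) ?_, ?_, ?_⟩
      · split_ifs
        · exact sub_mem (hg.1 e).1 (nsmul_mem (hH e) _)
        · exact zero_mem _
      · refine (add_eq_left.2 ?_).trans (hg1 _).symm
        split_ifs
        · simp [hH0, (hg.1 e).2.1]
        · simp
      · refine (add_eq_left.2 ?_).trans (hg1 _).symm
        split_ifs
        · simp [hHL, (hg.1 e).2.2]
        · simp
    · simp only [edgeElim_pairedLoop, len_pairedLoop, src_pairedLoop, tgt_pairedLoop, hc0,
        Nat.cast_one, one_mul]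
      exact ⟨(hcm _).1 _, (hg1 v).symm, (hg1 v).symm⟩
  · obtain ⟨r, i, rfl⟩ := pairedRay_surjective hε x
    simp only [rayElim_pairedRay, base_pairedRay, Nat.cast_one, one_mul, Pi.add_apply, hc0]
    refine ⟨add_mem (hcm _) ?_, ?_⟩
    · split_ifs
      · exact sub_mem (hg.2 r).1 (nsmul_mem (hcm _) _)
      · exact zero_mem _
    · refine (add_eq_left.2 ?_).trans (hg1 _).symm
      split_ifs
      · simp [hc0, (hg.2 r).2]
      · simp
  · refine Prod.ext rfl (Prod.ext (funext fun e => ?_) (funext fun r => ?_))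
    · simp only [pushFamily, edgeElim_pairedEdge]
      rw [Finset.sum_add_distrib, Finset.sum_ite_eq' Finset.univ]
      simp
    · simp only [pushFamily, rayElim_pairedRay]
      rw [Finset.sum_add_distrib, Finset.sum_ite_eq' Finset.univ]
      simp

/-- Presents the Picard group of Γ relative to Σ as divisors modulo divisors of weighted functions,
so that the parity argument applies to Γ too. -/
theorem mem_map_pushDiv_iff (D : Γ.graph.Divisor) :
    D ∈ (Γ.paired ε hε).principal.map (Γ.pushDiv ε hε) ↔
      ∃ g ∈ Γ.graph.weightedFunctions Γ.weightE Γ.weightR, ∀ p, D p = orderAt g p := by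
  rw [AddSubgroup.mem_map]
  constructor
  · rintro ⟨D', hD', rfl⟩
    obtain ⟨f, hf, h⟩ := (mem_principal_iff D').1 hD'
    exact ⟨_, pushFamily_mem hf, pushDiv_eq_orderAt hf h⟩
  · rintro ⟨g, hg, h⟩
    obtain ⟨f, hf, rfl⟩ := exists_pushFamily_eq (hε := hε) hg
    obtain ⟨D', hD'⟩ := exists_divisor_eq_orderAt hf
    refine ⟨D', (mem_principal_iff D').2 ⟨f, hf, hD'⟩, Finsupp.ext fun p => ?_⟩
    rw [h, pushDiv_eq_orderAt hf hD']

/-- A loop adds 2 to the valency of its vertex, and its interior points have coefficient 0 in the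
canonical divisor, so loops are invisible modulo 2. -/
theorem isCanonicalModTwo_pushDiv :
    IsCanonicalModTwo Γ.weightE Γ.weightR (Γ.pushDiv ε hε (Γ.paired ε hε).canonical) where
  vertex v := by
    have h1 : Γ.pushDiv ε hε (Γ.paired ε hε).canonical (.vertex v) =
        (Γ.paired ε hε).canonical (.vertex (pairedVertex hε v)) := by
      refine (Finsupp.mapDomain_apply_eq_sum_of_injective (ι := Unit) _ _ _
        (fun _ => .vertex (pairedVertex hε v)) (fun _ _ _ => rfl) (fun _ => rfl) ?_).trans (by simp)
      refine pairedPoint_induction hε ?_ ?_ ?_ ?_ ?_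
      all_goals simp only [pairing_vertex, pairing_edge, pairing_loop, pairing_ray, pairing_infty, reduceCtorEq,
      IsEmpty.forall_iff, implies_true, Point.vertex.injEq]
      · rintro _ rfl -
        exact ⟨(), rfl⟩
      · intro _ _ _ _ _ hne
        simp [canonical_apply, val] at hne
    have h2 : ((Γ.paired ε hε).star (pairedVertex hε v)).card = ∑ h ∈ Γ.graph.star v,
        Sum.elim (Sum.elim Γ.weightE Γ.weightE) Γ.weightR h + 2 * Γ.vertexWeight v := by
      rw [Finset.card_eq_sum_ones, sum_star_paired]
      simp [sumOver, mul_comm]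
    rw [h1, canonical_apply, val, h2]
    push_cast
    refine ⟨∑ h ∈ Γ.graph.star v, ((Sum.elim (Sum.elim Γ.weightE Γ.weightE) Γ.weightR h : ℕ) : ℤ) +
      Γ.vertexWeight v - 1, ?_⟩
    ring
  edge e t ht := by simp [pushDiv_edge, canonical_apply, val]
  ray r t ht := by simp [pushDiv_ray, canonical_apply, val]
  infty r := by simp [pushDiv_infty, canonical_apply, val]

theorem isThetaFunction_pushFamily {θ : (Γ.paired ε hε).Divisor}
    (hf : IsThetaFunction (fun _ => 1) (fun _ => 1) (Γ.paired ε hε).canonical θ f) :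
    IsThetaFunction Γ.weightE Γ.weightR (Γ.pushDiv ε hε (Γ.paired ε hε).canonical)
      (Γ.pushDiv ε hε θ) (pushFamily hε f) := by
  refine ⟨pushFamily_mem hf.mem, fun p => ?_⟩
  have := pushDiv_eq_orderAt (D := 2 • θ - (Γ.paired ε hε).canonical) hf.mem (fun p => by
    have := hf.eq p
    simp only [two_smul, Finsupp.coe_sub, Finsupp.coe_add, Pi.sub_apply, Pi.add_apply]
    linarith) p
  rw [← this, two_smul, map_sub, map_add]
  simp only [Finsupp.coe_sub, Finsupp.coe_add, Pi.sub_apply, Pi.add_apply]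
  ring

/-! ### The pushforward of chains modulo two -/

variable (Γ) (hε) in
/-- The pushforward of `1`-chains modulo two. -/
def pushChain : ((Γ.paired ε hε).E → ZMod 2) →ₗ[ZMod 2] (Γ.graph.E → ZMod 2) where
  toFun γ e := ∑ i, γ (pairedEdge hε e i)
  map_add' γ δ := by ext e; simp [Finset.sum_add_distrib]
  map_smul' c γ := by ext e; simp [Finset.mul_sum]

theorem pushChain_apply (γ : (Γ.paired ε hε).E → ZMod 2) (e : Γ.graph.E) :
    Γ.pushChain hε γ e = ∑ i, γ (pairedEdge hε e i) := rfl

/-- Slopes add up over parallel edges, and `w_e` is the sum of their weights 1. -/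
theorem slopeParity_pushFamily
    (hf : f ∈ (Γ.paired ε hε).weightedFunctions (fun _ => 1) (fun _ => 1)) :
    slopeParity Γ.weightE (pushFamily hε f) = Γ.pushChain hε (slopeParity (fun _ => 1) f) := by
  ext e
  have h : rightSlope ((pushFamily hε f).2.1 e) 0 =
      ∑ i, rightSlope (f.2.1 (pairedEdge hε e i)) 0 := slopeAlong_pushFamily hf (.inl (.inl e))
  simp only [slopeParity, h, pushChain_apply, Finset.sum_add_distrib]
  simp

/-- Vertices are unchanged, and a loop meets its vertex twice, hence not at all modulo 2. -/
theorem boundary_pushChain (γ : (Γ.paired ε hε).E → ZMod 2) (v : Γ.graph.V) :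
    Γ.graph.boundary (Γ.pushChain hε γ) v = (Γ.paired ε hε).boundary γ (pairedVertex hε v) := by
  classical
  rw [boundary_apply, boundary_apply, sum_paired_edges]
  simp only [pushChain_apply, src_pairedEdge, tgt_pairedEdge, src_pairedLoop, tgt_pairedLoop,
    pairedVertex_inj, CharTwo.add_self_eq_zero, Finset.sum_add_distrib, Finset.sum_ite_irrel,
    Finset.sum_const_zero, add_zero]

theorem pushChain_mem_ker_iff (γ : (Γ.paired ε hε).E → ZMod 2) :
    Γ.pushChain hε γ ∈ LinearMap.ker Γ.graph.boundary ↔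
      γ ∈ LinearMap.ker (Γ.paired ε hε).boundary := by
  rw [LinearMap.mem_ker, LinearMap.mem_ker, funext_iff, funext_iff]
  exact forall_congr' fun v => by rw [boundary_pushChain]; rfl

theorem pushChain_surjective : Function.Surjective (Γ.pushChain hε) := by
  intro γ
  refine ⟨edgeElim hε (fun e i => if i = ⟨0, Γ.weightE_pos e⟩ then γ e else 0) fun _ _ => 0, ?_⟩
  ext e
  simp [pushChain_apply]

/-- The fibre is a coset of the kernel, of dimension `|E_Σ| - |E_Γ|`. This is the difference of the
genera, the two graphs having the same vertices. -/
theorem ncard_pushChain_fiber (δ : Γ.graph.E → ZMod 2) :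
    {γ | Γ.pushChain hε γ = δ}.ncard = 2 ^ ((Γ.paired ε hε).genus - Γ.genus) := by
  classical
  obtain ⟨γ₀, rfl⟩ := pushChain_surjective (hε := hε) δ
  have himage : {γ | Γ.pushChain hε γ = Γ.pushChain hε γ₀} =
      (· + γ₀) '' (LinearMap.ker (Γ.pushChain hε) : Set ((Γ.paired ε hε).E → ZMod 2)) := by
    ext γ
    simp only [mem_ofPred_eq, mem_image, SetLike.mem_coe, LinearMap.mem_ker]
    constructor
    · intro h
      exact ⟨γ - γ₀, by rw [map_sub, h, sub_self], sub_add_cancel _ _⟩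
    · rintro ⟨x, hx, rfl⟩
      rw [map_add, hx, zero_add]
  rw [himage, ncard_image_of_injective _ (add_left_injective γ₀), ← Nat.card_coe_set_eq]
  have h1 := Module.natCard_eq_pow_finrank (K := ZMod 2) (V := LinearMap.ker (Γ.pushChain hε))
  rw [Nat.card_zmod] at h1
  refine h1.trans ?_
  congr 1
  have h2 := LinearMap.finrank_range_add_finrank_ker (Γ.pushChain hε)
  rw [LinearMap.range_eq_top.2 pushChain_surjective, finrank_top,
    Module.finrank_fintype_fun_eq_card, Module.finrank_fintype_fun_eq_card] at h2
  have h3 := Γ.graph.card_vertices_le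
  have h4 : Fintype.card (Γ.paired ε hε).V = Fintype.card Γ.graph.V := rfl
  rw [TropicalPlaneCurve.genus, MetricGraph.genus, MetricGraph.genus]
  omega

end TropicalPlaneCurve

/-! ### Theta classes on a metric graph as cycles modulo two -/

namespace MetricGraph

theorem toPic_two_smul_eq_iff {G : MetricGraph} {θ : G.Divisor} :
    G.toPic (2 • θ) = G.toPic G.canonical ↔
      ∃ f, IsThetaFunction (fun _ => 1) (fun _ => 1) G.canonical θ f :=
  mk_two_smul_eq_iff mem_principal_iff

/-- On a metric graph, the theta characteristic classes correspond to the cycles modulo two, and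
exactly the one that corresponds to zero is not effective. -/
theorem exists_bijOn_thetaClasses (G : MetricGraph) : ∃ Φ : G.Pic → G.E → ZMod 2,
    (∀ θ f, IsThetaFunction (fun _ => 1) (fun _ => 1) G.canonical θ f →
      Φ (G.toPic θ) = slopeParity (fun _ => 1) f) ∧
    BijOn Φ G.thetaClasses (LinearMap.ker G.boundary) ∧
    ∀ c ∈ G.thetaClasses, G.IsEffectiveClass c ↔ Φ c ≠ 0 := by
  obtain ⟨Φ, hΦ, hinj, hmaps⟩ := exists_slopeParity_map (fun _ => one_pos)
    isCanonicalModTwo_canonical (mem_principal_iff (G := G))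
  have hsurj : ∀ γ ∈ LinearMap.ker G.boundary, ∃ θ : G.Divisor, G.toPic θ ∈ G.thetaClasses ∧
      Φ (G.toPic θ) = γ ∧ (γ ≠ 0 → ∀ p, 0 ≤ θ p) := by
    intro γ hγ
    obtain ⟨θ, f, hf, h1, h2⟩ := exists_isThetaFunction hγ
    exact ⟨θ, ⟨θ, rfl, toPic_two_smul_eq_iff.2 ⟨f, hf⟩⟩, (hΦ θ f hf).trans h1, h2⟩
  refine ⟨Φ, hΦ, ⟨hmaps, hinj, fun γ hγ => ?_⟩, fun c hc => ⟨?_, fun hne => ?_⟩⟩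
  · obtain ⟨θ, h1, h2, -⟩ := hsurj γ hγ
    exact ⟨_, h1, h2⟩
  · rintro ⟨D, hD, rfl⟩ h0
    obtain ⟨θ, hθ, h2⟩ := hc
    -- The effective representative `D` is itself a theta characteristic, so `not_effective` applies
    -- to it.
    have h3 : G.toPic (2 • D) = G.toPic G.canonical := by
      rw [← h2]
      exact congrArg (2 • ·) hθ.symm
    obtain ⟨f, hf⟩ := toPic_two_smul_eq_iff.1 h3
    exact hf.not_effective ((hΦ D f hf).symm.trans h0) hD
  · obtain ⟨θ, h1, h2, h3⟩ := hsurj _ (hmaps hc)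
    exact ⟨θ, h3 hne, hinj h1 hc h2⟩

end MetricGraph

end

/-! ### Counting the classes over the curve -/

open MetricGraph TropicalPlaneCurve

theorem lemma2p6 (Γ : TropicalPlaneCurve) (ε : ℝ) (hε : 0 < ε) :
    Set.MapsTo (Γ.pushPic ε hε) (Γ.paired ε hε).thetaClasses (Γ.thetaClasses ε hε) ∧
    (Γ.thetaClasses ε hε).ncard = 2 ^ Γ.genus ∧
    (∀ η ∈ Γ.thetaClasses ε hε,
      (Γ.thetaFiber ε hε η).ncard = 2 ^ ((Γ.paired ε hε).genus - Γ.genus)) ∧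
    ∃ η₀ ∈ Γ.thetaClasses ε hε,
      Γ.multiplicity ε hε η₀ = 2 ^ ((Γ.paired ε hε).genus - Γ.genus) - 1 ∧
      ∀ η ∈ Γ.thetaClasses ε hε, η ≠ η₀ →
        Γ.multiplicity ε hε η = 2 ^ ((Γ.paired ε hε).genus - Γ.genus) := by
  obtain ⟨Φ, hΦ, hbij, heff⟩ := (Γ.paired ε hε).exists_bijOn_thetaClasses
  obtain ⟨Ψ, hΨ, hinj, hmaps⟩ := exists_slopeParity_map Γ.weightE_pos
    (isCanonicalModTwo_pushDiv (hε := hε)) mem_map_pushDiv_iff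
  have hpush : ∀ c ∈ (Γ.paired ε hε).thetaClasses, Γ.pushPic ε hε c ∈ Γ.thetaClasses ε hε ∧
      Ψ (Γ.pushPic ε hε c) = Γ.pushChain hε (Φ c) := by
    rintro _ ⟨θ, rfl, hθ⟩
    obtain ⟨f, hf⟩ := toPic_two_smul_eq_iff.1 hθ
    have hf' := isThetaFunction_pushFamily hf
    refine ⟨⟨Γ.pushDiv ε hε θ, rfl, (mk_two_smul_eq_iff mem_map_pushDiv_iff).2 ⟨_, hf'⟩⟩, ?_⟩
    rw [hΦ θ f hf, ← slopeParity_pushFamily hf.mem]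
    exact hΨ _ _ hf'
  have hinj : InjOn Ψ (Γ.thetaClasses ε hε) := hinj
  have hmaps : MapsTo Ψ (Γ.thetaClasses ε hε) (LinearMap.ker Γ.graph.boundary) := hmaps
  -- Surjectivity comes from Σ: lift a cycle to a chain, which is again a cycle, and push forward
  -- its theta class.
  have hbij' : BijOn Ψ (Γ.thetaClasses ε hε) (LinearMap.ker Γ.graph.boundary) := by
    refine ⟨hmaps, hinj, fun δ hδ => ?_⟩
    obtain ⟨γ, rfl⟩ := pushChain_surjective (hε := hε) δ
    obtain ⟨c, hc, rfl⟩ := hbij.surjOn ((pushChain_mem_ker_iff γ).1 hδ)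
    exact ⟨_, (hpush c hc).1, (hpush c hc).2⟩
  -- The whole fibre of `pushChain` occurs, since every chain over a cycle is a cycle.
  have hfiber : ∀ η ∈ Γ.thetaClasses ε hε,
      Φ '' Γ.thetaFiber ε hε η = {γ | Γ.pushChain hε γ = Ψ η} := by
    intro η hη
    ext γ
    constructor
    · rintro ⟨c, ⟨hc, rfl⟩, rfl⟩
      exact (hpush c hc).2.symm
    · intro hγ
      have hγ : Γ.pushChain hε γ = Ψ η := hγ
      obtain ⟨c, hc, rfl⟩ := hbij.surjOn ((pushChain_mem_ker_iff γ).1 (hγ ▸ hmaps hη))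
      exact ⟨c, ⟨hc, hinj (hpush c hc).1 hη ((hpush c hc).2.trans hγ)⟩, rfl⟩
  have hfiberInj : ∀ η, InjOn Φ (Γ.thetaFiber ε hε η) := fun η =>
    hbij.injOn.mono fun c hc => hc.1
  have hcard : ∀ η ∈ Γ.thetaClasses ε hε,
      (Γ.thetaFiber ε hε η).ncard = 2 ^ ((Γ.paired ε hε).genus - Γ.genus) := fun η hη => by
    rw [← (hfiberInj η).ncard_image, hfiber η hη, ncard_pushChain_fiber]
  refine ⟨fun c hc => (hpush c hc).1, ?_, hcard, ?_⟩
  · rw [← hinj.ncard_image, hbij'.image_eq, ncard_ker_boundary]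
    rfl
  -- `c₀` is the only theta class on Σ that is not effective; its image is the exceptional class.
  obtain ⟨c₀, hc₀, h0⟩ := hbij.surjOn (LinearMap.ker (Γ.paired ε hε).boundary).zero_mem
  have hη₀ : Ψ (Γ.pushPic ε hε c₀) = 0 := by rw [(hpush c₀ hc₀).2, h0, map_zero]
  refine ⟨_, (hpush c₀ hc₀).1, ?_, fun η hη hne => ?_⟩
  · have hset : {θ | θ ∈ Γ.thetaFiber ε hε (Γ.pushPic ε hε c₀) ∧
        (Γ.paired ε hε).IsEffectiveClass θ} =
        Γ.thetaFiber ε hε (Γ.pushPic ε hε c₀) \ {c₀} := by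
      ext c
      refine and_congr_right fun hc => (heff c hc.1).trans (not_congr ?_)
      exact ⟨fun h => hbij.injOn hc.1 hc₀ (h.trans h0.symm), fun h => by
        rw [mem_singleton_iff.1 h]; exact h0⟩
    rw [TropicalPlaneCurve.multiplicity, hset, ncard_sdiff_singleton_of_mem
      (show c₀ ∈ Γ.thetaFiber ε hε (Γ.pushPic ε hε c₀) from ⟨hc₀, rfl⟩), hcard _ (hpush c₀ hc₀).1]
  · rw [← hcard η hη, TropicalPlaneCurve.multiplicity]
    congr 1
    ext c
    -- A class over `η` that is not effective has cycle zero, so `Ψ η = 0` and `η` is the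
    -- exceptional class.
    refine and_iff_left_of_imp fun hc => (heff c hc.1).2 fun h => hne ?_
    refine hinj hη (hpush c₀ hc₀).1 (hη₀.symm ▸ ?_)
    rw [← hc.2, (hpush c hc.1).2, h, map_zero]
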